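/- An $n$-weighted tournament ($n\ge 1$) is a pair $T=(V,w)$ of a finite set $V$ of alternatives and a function $w\colon V\times V\to\{0,\dots,n\}$ with $w(x,y)+w(y,x)=n$ for all distinct $x,y\in V$. Put $m_T(x,y)=w(x,y)-w(y,x)$; the margin graph has an edge $(x,y)$ whenever $x\ne y$ and $m_T(x,y)>0$. A dominance cycle is a sequence $(x_1,\dots,x_k)$ with $k>1$, $x_1=x_k$ and $m_T(x_i,x_{i+1})>0$ for all $i<k$; its splitting edges are its edges $(x_i,x_{i+1})$ of minimum margin. The Split Cycle winners $\mathsf{SC}(T)$ are the alternatives without incoming edges after the splitting edges of all dominance cycles have been deleted from the margin graph. A reversal function is a map $R\colon V\times V\to\{-n,\dots,n\}$ with $R(x,y)=-R(y,x)$ and $0\le w(x,y)+R(x,y)\le n$; it yields the $n$-weighted tournament $T^R=(V,w+R)$, and its size is $\sum_{R(y,z)>0}R(y,z)$. For $a\in\mathsf{SC}(T)$, a weighted destructive reversal set (wDRS) is a reversal function $R$ with $a\notin\mathsf{SC}(T^R)$, and the margin of victory $\mathrm{MoV}(a,T)$ is the minimum size of a wDRS for $a$ in $T$. **Theorem.**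 The margin of victory of a Split Cycle winner can be computed in polynomial time: there is an algorithm (one program for a random access machine with unit-cost addition, subtraction, comparison with zero and indirect addressing) which, given an $n$-weighted tournament $T=(V,w)$ with $|V|\ge 2$ and an alternative $a\in\mathsf{SC}(T)$, computes $\mathrm{MoV}(a,T)$ together with a wDRS for $a$ of that minimum size, in a number of steps that is bounded by a polynomial in $|V|$ and $n$. -/

import Mathlib

/-- An `n`-weighted tournament on the set `V` of alternatives: weights in `{0, …, n}` such that
`w x y + w y x = n` for distinct `x, y` (the diagonal is unconstrained). -/
structure WeightedTournament (V : Type*) (n : ℕ) where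
  w : V → V → ℕ
  le_n : ∀ x y, w x y ≤ n
  add_eq : ∀ x y, x ≠ y → w x y + w y x = n

namespace WeightedTournament

variable {V : Type*} {n : ℕ}

/-- The majority margin of `x` over `y`. -/
def margin (T : WeightedTournament V n) (x y : V) : ℤ :=
  (T.w x y : ℤ) - (T.w y x : ℤ)

/-- The margin graph: `x` has an edge to `y` iff `x` dominates `y`. -/
def marginGraph (T : WeightedTournament V n) : Digraph V where
  Adj x y := x ≠ y ∧ 0 < T.margin x y

/-- A dominance cycle `(x_0, …, x_len)` with `len ≥ 1`, `x_0 = x_len` and positive margins between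
consecutive alternatives. -/
structure DominanceCycle (T : WeightedTournament V n) where
  len : ℕ
  len_pos : 0 < len
  vert : Fin (len + 1) → V
  closed : vert 0 = vert (Fin.last len)
  margin_pos : ∀ i : Fin len, 0 < T.margin (vert i.castSucc) (vert i.succ)

/-- The splitting number of a dominance cycle: its smallest margin between consecutive
alternatives. -/
def DominanceCycle.splittingNumber {T : WeightedTournament V n} (C : T.DominanceCycle) : ℤ :=
  Finset.univ.inf' ⟨⟨0, C.len_pos⟩, Finset.mem_univ _⟩
    fun i : Fin C.len => T.margin (C.vert i.castSucc) (C.vert i.succ)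

/-- The splitting edges of a dominance cycle: its edges of minimum margin. -/
def DominanceCycle.splittingEdges {T : WeightedTournament V n} (C : T.DominanceCycle) :
    Set (V × V) :=
  {e | ∃ i : Fin C.len, e = (C.vert i.castSucc, C.vert i.succ) ∧
    T.margin (C.vert i.castSucc) (C.vert i.succ) = C.splittingNumber}

/-- The subgraph of the margin graph in which every splitting edge of every dominance cycle is
deleted. -/
def deletedMarginGraph (T : WeightedTournament V n) : Digraph V where
  Adj x y := T.marginGraph.Adj x y ∧ ∀ C : T.DominanceCycle, (x, y) ∉ C.splittingEdges

/-- The Split Cycle winners: the alternatives that are undominated after the deletion. -/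
def splitCycle (T : WeightedTournament V n) : Set V :=
  {x | ∀ y, ¬ T.deletedMarginGraph.Adj y x}

/-- A reversal function for `T`. -/
structure Reversal (T : WeightedTournament V n) where
  R : V → V → ℤ
  mem_range : ∀ x y, -(n : ℤ) ≤ R x y ∧ R x y ≤ n
  antisymm : ∀ x y, R x y = -R y x
  nonneg : ∀ x y, 0 ≤ (T.w x y : ℤ) + R x y
  le_n : ∀ x y, (T.w x y : ℤ) + R x y ≤ n

/-- The tournament with weights `w x y + R x y` (which are nonnegative by assumption on `R`). -/
def reverse (T : WeightedTournament V n) (R : T.Reversal) : WeightedTournament V n where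
  w x y := ((T.w x y : ℤ) + R.R x y).toNat
  le_n x y := by
    have h := R.le_n x y
    omega
  add_eq x y hxy := by
    have h₁ := T.add_eq x y hxy
    have h₂ := R.antisymm x y
    have h₃ := R.nonneg x y
    have h₄ := R.nonneg y x
    omega

/-- The size of a reversal function: the total weight of its positive values. -/
def Reversal.size [Fintype V] {T : WeightedTournament V n} (R : T.Reversal) : ℤ :=
  ∑ p : V × V with 0 < R.R p.1 p.2, R.R p.1 p.2

/-- `R` is a weighted destructive reversal set for the winner `a` of `T` under the tournament
solution `S`. -/
def IsWDRS (S : WeightedTournament V n → Set V) (T : WeightedTournament V n) (a : V)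
    (R : T.Reversal) : Prop :=
  a ∈ S T ∧ a ∉ S (T.reverse R)

/-- `v` is the margin of victory of the winner `a` of `T` under the tournament solution `S`:
the minimum size of a weighted destructive reversal set for `a` (in particular, one exists). -/
def IsMarginOfVictory [Fintype V] (S : WeightedTournament V n → Set V)
    (T : WeightedTournament V n) (a : V) (v : ℤ) : Prop :=
  IsLeast {s : ℤ | ∃ R : T.Reversal, IsWDRS S T a R ∧ R.size = s} v

end WeightedTournament

/-! A random access machine, programmed by structured (while) programs. It has registers, which are
named in the program text, and a memory, which is addressed indirectly through registers; both hold
natural numbers. Every elementary instruction and every test takes one step. The only arithmetic is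
addition and truncated subtraction, so that the largest number held at most doubles in a step
(up to the finitely many constants of the program), and this unit-cost measure is polynomially
related to running times of Turing machines. -/

namespace RAM

/-- The state of the machine. -/
structure State where
  reg : ℕ → ℕ
  mem : ℕ → ℕ

/-- Programs of the machine. -/
inductive Program
  /-- `reg i := c` -/
  | const (i c : ℕ)
  /-- `reg i := reg j` -/
  | copy (i j : ℕ)
  /-- `reg i := reg j + reg k` -/
  | add (i j k : ℕ)
  /-- `reg i := reg j - reg k`, truncated at `0` -/
  | sub (i j k : ℕ)
  /-- `reg i := mem (reg j)` -/
  | load (i j : ℕ)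
  /-- `mem (reg i) := reg j` -/
  | store (i j : ℕ)
  /-- `p`, then `q` -/
  | seq (p q : Program)
  /-- `p` if `reg i ≠ 0`, and `q` otherwise -/
  | branch (i : ℕ) (p q : Program)
  /-- `p` again and again, as long as `reg i ≠ 0` -/
  | loop (i : ℕ) (p : Program)

/-- `RunsIn p s t s'`: started in the state `s`, the program `p` halts after exactly `t` steps, in
the state `s'`. -/
inductive RunsIn : Program → State → ℕ → State → Prop
  | const (i c : ℕ) (s : State) :
      RunsIn (.const i c) s 1 ⟨Function.update s.reg i c, s.mem⟩
  | copy (i j : ℕ) (s : State) :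
      RunsIn (.copy i j) s 1 ⟨Function.update s.reg i (s.reg j), s.mem⟩
  | add (i j k : ℕ) (s : State) :
      RunsIn (.add i j k) s 1 ⟨Function.update s.reg i (s.reg j + s.reg k), s.mem⟩
  | sub (i j k : ℕ) (s : State) :
      RunsIn (.sub i j k) s 1 ⟨Function.update s.reg i (s.reg j - s.reg k), s.mem⟩
  | load (i j : ℕ) (s : State) :
      RunsIn (.load i j) s 1 ⟨Function.update s.reg i (s.mem (s.reg j)), s.mem⟩
  | store (i j : ℕ) (s : State) :
      RunsIn (.store i j) s 1 ⟨s.reg, Function.update s.mem (s.reg i) (s.reg j)⟩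
  | seq {p q : Program} {s s' s'' : State} {t t' : ℕ} :
      RunsIn p s t s' → RunsIn q s' t' s'' → RunsIn (.seq p q) s (t + t') s''
  | branch_true {i : ℕ} {p q : Program} {s s' : State} {t : ℕ} :
      s.reg i ≠ 0 → RunsIn p s t s' → RunsIn (.branch i p q) s (t + 1) s'
  | branch_false {i : ℕ} {p q : Program} {s s' : State} {t : ℕ} :
      s.reg i = 0 → RunsIn q s t s' → RunsIn (.branch i p q) s (t + 1) s'
  | loop_true {i : ℕ} {p : Program} {s s' s'' : State} {t t' : ℕ} :
      s.reg i ≠ 0 → RunsIn p s t s' → RunsIn (.loop i p) s' t' s'' →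
        RunsIn (.loop i p) s (t + t' + 1) s''
  | loop_false {i : ℕ} {p : Program} {s : State} :
      s.reg i = 0 → RunsIn (.loop i p) s 1 s

/-- The initial state on the input `(T, a)`: the number `m` of alternatives, the number `n` and the
alternative `a` are in the registers `0`, `1`, `2`, the weight `w x y` is at the address
`x * m + y` of the memory, and everything else is `0`. -/
def inputState {m n : ℕ} (T : WeightedTournament (Fin m) n) (a : Fin m) : State where
  reg i := if i = 0 then m else if i = 1 then n else if i = 2 then a else 0
  mem k :=
    if h : k < m * m then
      T.w ⟨k / m, Nat.div_lt_of_lt_mul h⟩ ⟨k % m, Nat.mod_lt k (Nat.pos_of_lt_mul_left h)⟩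
    else 0

end RAM

/-! After a reversal, `a` loses exactly if some `y` beats `a` and the edge `(y, a)` splits no
dominance cycle, that is, no path from `a` to `y` consists of edges with at least the margin of `(y,
a)`. Let `A` be the set of alternatives reachable from `a` by such edges. Then `a` loses iff there
are `y`, a threshold `v` with `n < 2 * v ≤ 2 * n`, and a set `A` containing `a` but not `y` such
that the new weight of `(y, a)` is at least `v` and all new weights from `A` to its complement are
below `v` (`exists_cut_of_notMem_splitCycle`, `notMem_splitCycle_of_cut`).

For fixed `y`, `v`, `A` the cheapest way to achieve this acts on each pair separately. It costs `v -
w y a` (truncated) for the pair `(y, a)` and `w x z - (v - 1)` (truncated) for every other pair `(x,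
z)` leaving `A`; the pair `(a, y)` is free, since its weight becomes at most `n - v < v`. So the
margin of victory is the minimum over `y` and `v` of `v - w y a` plus the value of a minimum cut
between `a` and `y` (`IsWDRS.exists_cut`, `isWDRS_cutReversal`, `sum_cutReversalPos`). There are at
most `m * n` pairs `(y, v)`.

The minimum cut is found by a variant of push-relabel that moves one unit of flow at a time,
downhill along residual arcs, raising the label of its position when it is stuck. Once that label
reaches the number of vertices, the labels have a gap, and the vertices above it form a minimum cut
(`exists_minimum_cut`). A potential that grows in each step bounds the number of steps
(`potential_le`).

For the machine, the algorithm is written as a function on abstract stores. `PolyExpr` and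
`PolyImpl` are closed under the constructions used, so running time and correctness are proved
separately: `polyImpl_main` gives the program, `tryAll_spec` the optimality. -/

namespace RAM

/-- Started in `s`, the program `p` halts after at most `B` steps in a state satisfying `Q`. -/
def Exec (p : Program) (s : State) (B : ℕ) (Q : State → Prop) : Prop :=
  ∃ t s', RunsIn p s t s' ∧ t ≤ B ∧ Q s'

/-! ### Total correctness rules with step bounds -/

namespace Exec

variable {p q : Program} {s : State} {B B' : ℕ} {Q Q' : State → Prop}

theorem mono (h : Exec p s B Q) (hB : B ≤ B') (hQ : ∀ s', Q s' → Q' s') : Exec p s B' Q' := by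
  obtain ⟨t, s', hr, ht, hq⟩ := h
  exact ⟨t, s', hr, ht.trans hB, hQ _ hq⟩

theorem const {i c : ℕ} (h : Q ⟨Function.update s.reg i c, s.mem⟩) : Exec (.const i c) s 1 Q :=
  ⟨1, _, .const i c s, le_rfl, h⟩

theorem copy {i j : ℕ} (h : Q ⟨Function.update s.reg i (s.reg j), s.mem⟩) :
    Exec (.copy i j) s 1 Q :=
  ⟨1, _, .copy i j s, le_rfl, h⟩

theorem add {i j k : ℕ} (h : Q ⟨Function.update s.reg i (s.reg j + s.reg k), s.mem⟩) :
    Exec (.add i j k) s 1 Q :=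
  ⟨1, _, .add i j k s, le_rfl, h⟩

theorem sub {i j k : ℕ} (h : Q ⟨Function.update s.reg i (s.reg j - s.reg k), s.mem⟩) :
    Exec (.sub i j k) s 1 Q :=
  ⟨1, _, .sub i j k s, le_rfl, h⟩

theorem load {i j : ℕ} (h : Q ⟨Function.update s.reg i (s.mem (s.reg j)), s.mem⟩) :
    Exec (.load i j) s 1 Q :=
  ⟨1, _, .load i j s, le_rfl, h⟩

theorem store {i j : ℕ} (h : Q ⟨s.reg, Function.update s.mem (s.reg i) (s.reg j)⟩) :
    Exec (.store i j) s 1 Q :=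
  ⟨1, _, .store i j s, le_rfl, h⟩

theorem seq (h : Exec p s B fun s' => Exec q s' B' Q) : Exec (.seq p q) s (B + B') Q := by
  obtain ⟨t, s', hr, ht, t', s'', hr', ht', hq⟩ := h
  exact ⟨t + t', s'', .seq hr hr', by omega, hq⟩

theorem branch {i : ℕ} (h₁ : s.reg i ≠ 0 → Exec p s B Q) (h₂ : s.reg i = 0 → Exec q s B' Q) :
    Exec (.branch i p q) s (B + B' + 1) Q := by
  by_cases hi : s.reg i = 0
  · obtain ⟨t, s', hr, ht, hq⟩ := h₂ hi
    exact ⟨t + 1, s', .branch_false hi hr, by omega, hq⟩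
  · obtain ⟨t, s', hr, ht, hq⟩ := h₁ hi
    exact ⟨t + 1, s', .branch_true hi hr, by omega, hq⟩

/-- The register `r` counts the remaining rounds, so the invariant determines when the loop stops. A
round costs its body and one test; the last test costs one more. -/
theorem loop {r N : ℕ} (Inv : ℕ → State → Prop)
    (hr : ∀ i ≤ N, ∀ s, Inv i s → s.reg r = N - i)
    (hb : ∀ i < N, ∀ s, Inv i s → Exec p s B (Inv (i + 1))) (h₀ : Inv 0 s) :
    Exec (.loop r p) s (N * (B + 1) + 1) (Inv N) := by
  suffices H : ∀ j i s, i + j = N → Inv i s → Exec (.loop r p) s (j * (B + 1) + 1) (Inv N) from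
    H N 0 s (by omega) h₀
  intro j
  induction j with
  | zero =>
    intro i s hi h
    obtain rfl : i = N := by omega
    exact ⟨1, s, .loop_false (by rw [hr i le_rfl s h]; omega), by omega, h⟩
  | succ j ih =>
    intro i s hi h
    obtain ⟨t, s', hr', ht, hq⟩ := hb i (by omega) s h
    obtain ⟨t', s'', hr'', ht', hq'⟩ := ih (i + 1) s' (by omega) hq
    refine ⟨t + t' + 1, s'', .loop_true (by rw [hr i (by omega) s h]; omega) hr' hr'', ?_, hq'⟩
    rw [Nat.succ_mul]
    omega

end Exec

/-! ### Abstract stores and their representation in the machine -/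

/-- An abstract store: natural numbers, indices of alternatives, and square arrays. -/
@[ext] structure Store (m : ℕ) where
  val : ℕ → ℕ
  idx : ℕ → Fin m
  arr : ℕ → Fin m → Fin m → ℕ

namespace Store

variable {m : ℕ}

def setVal (σ : Store m) (i c : ℕ) : Store m := { σ with val := Function.update σ.val i c }

def setIdx (σ : Store m) (i : ℕ) (x : Fin m) : Store m :=
  { σ with idx := Function.update σ.idx i x }

def setArr (σ : Store m) (j : ℕ) (f : Fin m → Fin m → ℕ) : Store m :=
  { σ with arr := Function.update σ.arr j f }

@[simp] theorem val_setVal (σ : Store m) (i c i' : ℕ) :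
    (σ.setVal i c).val i' = if i' = i then c else σ.val i' := Function.update_apply ..

@[simp] theorem idx_setVal (σ : Store m) (i c : ℕ) : (σ.setVal i c).idx = σ.idx := rfl

@[simp] theorem arr_setVal (σ : Store m) (i c : ℕ) : (σ.setVal i c).arr = σ.arr := rfl

@[simp] theorem val_setIdx (σ : Store m) (i : ℕ) (x : Fin m) : (σ.setIdx i x).val = σ.val := rfl

@[simp] theorem idx_setIdx (σ : Store m) (i i' : ℕ) (x : Fin m) :
    (σ.setIdx i x).idx i' = if i' = i then x else σ.idx i' := Function.update_apply ..

@[simp] theorem arr_setIdx (σ : Store m) (i : ℕ) (x : Fin m) : (σ.setIdx i x).arr = σ.arr := rfl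

@[simp] theorem val_setArr (σ : Store m) (j : ℕ) (f : Fin m → Fin m → ℕ) :
    (σ.setArr j f).val = σ.val := rfl

@[simp] theorem idx_setArr (σ : Store m) (j : ℕ) (f : Fin m → Fin m → ℕ) :
    (σ.setArr j f).idx = σ.idx := rfl

@[simp] theorem arr_setArr (σ : Store m) (j j' : ℕ) (f : Fin m → Fin m → ℕ) :
    (σ.setArr j f).arr j' = if j' = j then f else σ.arr j' := Function.update_apply ..

end Store

/-- The state `s` represents the store `σ`, for the sizes `m` and `n`. The registers `3 * k + 10`
hold temporary values. -/
structure Represents {m : ℕ} (n : ℕ) (σ : Store m) (s : State) : Prop where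
  size : s.reg 0 = m
  bound : s.reg 1 = n
  val : ∀ i, s.reg (3 * i + 8) = σ.val i
  idx : ∀ i, s.reg (3 * i + 9) = σ.idx i
  arr : ∀ (j : ℕ) (x y : Fin m), s.mem ((j * m + x) * m + y) = σ.arr j x y

/-- The states differ at most in the temporary values from the `k`-th on. -/
structure Agree (k : ℕ) (s s' : State) : Prop where
  mem : s'.mem = s.mem
  reg : ∀ r, (∀ l, k ≤ l → r ≠ 3 * l + 10) → s'.reg r = s.reg r

namespace Agree

variable {k k' : ℕ} {s s' s'' : State}

theorem refl (k : ℕ) (s : State) : Agree k s s := ⟨rfl, fun _ _ => rfl⟩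

theorem trans (h : Agree k s s') (h' : Agree k s' s'') : Agree k s s'' :=
  ⟨h'.mem.trans h.mem, fun r hr => (h'.reg r hr).trans (h.reg r hr)⟩

theorem mono (h : Agree k' s s') (hk : k ≤ k') : Agree k s s' :=
  ⟨h.mem, fun r hr => h.reg r fun l hl => hr l (hk.trans hl)⟩

theorem update (h : Agree k s s') {l : ℕ} (hl : k ≤ l) (c : ℕ) :
    Agree k s ⟨Function.update s'.reg (3 * l + 10) c, s'.mem⟩ :=
  ⟨h.mem, fun r hr => by
    simp only [Function.update_of_ne (hr l hl)]
    exact h.reg r hr⟩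

theorem tmp (h : Agree k s s') {l : ℕ} (hl : l < k) :
    s'.reg (3 * l + 10) = s.reg (3 * l + 10) :=
  h.reg _ fun l' hl' => by omega

end Agree

namespace Represents

variable {m n k : ℕ} {σ : Store m} {s s' : State}

/-- Temporaries have numbers congruent to 1 modulo 3 and at least 10; values and indices lie in the
other two residue classes, and the sizes are in registers 0 and 1. -/
theorem agree (h : Represents n σ s) (h' : Agree k s s') : Represents n σ s' where
  size := by rw [h'.reg 0 (by omega), h.size]
  bound := by rw [h'.reg 1 (by omega), h.bound]
  val i := by rw [h'.reg _ (by omega), h.val]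
  idx i := by rw [h'.reg _ (by omega), h.idx]
  arr j x y := by rw [h'.mem, h.arr]

theorem update_tmp (h : Represents n σ s) (l c : ℕ) :
    Represents n σ ⟨Function.update s.reg (3 * l + 10) c, s.mem⟩ :=
  h.agree ((Agree.refl l s).update le_rfl c)

theorem update_idx (h : Represents n σ s) (i : ℕ) (x : Fin m) :
    Represents n (σ.setIdx i x) ⟨Function.update s.reg (3 * i + 9) x, s.mem⟩ where
  size := by simpa [Function.update_apply] using h.size
  bound := by
    simp only [Function.update_apply]
    rw [if_neg (by omega), h.bound]
  val i' := by
    simp only [Function.update_apply]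
    rw [if_neg (by omega), h.val]; rfl
  idx i' := by
    by_cases hi : i' = i
    · simp [hi]
    · simp [hi, h.idx]
  arr := h.arr

theorem update_val (h : Represents n σ s) (i c : ℕ) :
    Represents n (σ.setVal i c) ⟨Function.update s.reg (3 * i + 8) c, s.mem⟩ where
  size := by simpa [Function.update_apply] using h.size
  bound := by
    simp only [Function.update_apply]
    rw [if_neg (by omega), h.bound]
  val i' := by
    by_cases hi : i' = i
    · simp [hi]
    · simp [hi, h.val]
  idx i' := by
    simp only [Function.update_apply]
    rw [if_neg (by omega), h.idx]; rfl
  arr := h.arr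

/-- Division with remainder by `m`, done twice, recovers the three coordinates. Hence writing one
cell affects no other cell of any array. -/
theorem address_inj {m j j' : ℕ} {x y x' y' : Fin m}
    (h : (j * m + x) * m + (y : ℕ) = (j' * m + x') * m + y') : j = j' ∧ x = x' ∧ y = y' := by
  have hm : 0 < m := x.pos
  have key : ∀ (q r : ℕ), r < m → (q * m + r) / m = q ∧ (q * m + r) % m = r := fun q r hr => by
    rw [mul_comm]
    exact ⟨by rw [Nat.mul_add_div hm, Nat.div_eq_of_lt hr, add_zero],
      by rw [Nat.mul_add_mod, Nat.mod_eq_of_lt hr]⟩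
  obtain ⟨h₁, h₂⟩ := key (j * m + x) y y.2
  obtain ⟨h₃, h₄⟩ := key (j' * m + x') y' y'.2
  rw [h] at h₁ h₂
  have h₅ := h₁.symm.trans h₃
  obtain ⟨h₆, h₇⟩ := key j x x.2
  obtain ⟨h₈, h₉⟩ := key j' x' x'.2
  rw [h₅] at h₆ h₇
  exact ⟨h₆.symm.trans h₈, Fin.ext (h₇.symm.trans h₉), Fin.ext (h₂.symm.trans h₄)⟩

theorem update_arr (h : Represents n σ s) (j c : ℕ) (x y : Fin m) :
    Represents n
      (σ.setArr j fun x' y' => if x' = x ∧ y' = y then c else σ.arr j x' y')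
      ⟨s.reg, Function.update s.mem ((j * m + x) * m + y) c⟩ where
  size := h.size
  bound := h.bound
  val := h.val
  idx := h.idx
  arr j' x' y' := by
    by_cases hj : (j' * m + x') * m + (y' : ℕ) = (j * m + x) * m + y
    · obtain ⟨rfl, rfl, rfl⟩ := address_inj hj
      simp
    · simp only [Function.update_of_ne hj, h.arr, Store.arr_setArr]
      split_ifs with h₁
      · subst h₁
        refine (if_neg ?_).symm
        rintro ⟨rfl, rfl⟩
        exact hj rfl
      · rfl

end Represents

/-! ### Polynomial-time expressions and transformations -/

/-- The expression `E` in the store, depending on the sizes `m` and `n`, can be evaluated in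
polynomial time without side effects. -/
def PolyExpr (E : ∀ m : ℕ, ℕ → Store m → ℕ) : Prop :=
  ∀ k, ∃ (p : Program) (P : Polynomial ℕ), ∀ (m n : ℕ) (σ : Store m) (s : State),
    Represents n σ s → Exec p s (P.eval (m + n)) fun s' =>
      Agree k s s' ∧ s'.reg (3 * k + 10) = E m n σ

/-- The transformation `F` of the store can be carried out in polynomial time. -/
def PolyImpl (F : ∀ m : ℕ, ℕ → Store m → Store m) : Prop :=
  ∀ k, ∃ (p : Program) (P : Polynomial ℕ), ∀ (m n : ℕ) (σ : Store m) (s : State),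
    Represents n σ s → Exec p s (P.eval (m + n)) fun s' =>
      Represents n (F m n σ) s' ∧ ∀ l < k, s'.reg (3 * l + 10) = s.reg (3 * l + 10)

/-- Multiplies the `k`-th temporary value by `m`. -/
def mulSize (k : ℕ) : Program :=
  .seq (.const (3 * (k + 1) + 10) 0) <|
  .seq (.copy (3 * (k + 2) + 10) 0) <|
  .seq (.const (3 * (k + 3) + 10) 1) <|
  .seq (.loop (3 * (k + 2) + 10) <|
    .seq (.add (3 * (k + 1) + 10) (3 * (k + 1) + 10) (3 * k + 10))
      (.sub (3 * (k + 2) + 10) (3 * (k + 2) + 10) (3 * (k + 3) + 10))) <|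
  .copy (3 * k + 10) (3 * (k + 1) + 10)

theorem exec_mulSize {m : ℕ} (k : ℕ) (s : State) (hm : s.reg 0 = m) :
    Exec (mulSize k) s (3 * m + 5) fun s' =>
      Agree k s s' ∧ s'.reg (3 * k + 10) = s.reg (3 * k + 10) * m := by
  unfold mulSize
  refine Exec.mono (Exec.seq <| Exec.const <| Exec.seq <| Exec.copy <| Exec.seq <| Exec.const <|
    Exec.seq <| (Exec.loop (N := m) (B := 2) (fun i s' => Agree (k + 1) s s' ∧
      s'.reg (3 * (k + 1) + 10) = s.reg (3 * k + 10) * i ∧ s'.reg (3 * (k + 2) + 10) = m - i ∧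
      s'.reg (3 * (k + 3) + 10) = 1) ?_ ?_ ?_).mono le_rfl
      fun s' h => Exec.copy ?_) (B := 1 + (1 + (1 + ((m * (2 + 1) + 1) + 1)))) (by omega)
      fun s' h => h
  · exact fun i hi s' h => h.2.2.1
  · rintro i hi s' ⟨h₁, h₂, h₃, h₄⟩
    refine Exec.seq <| Exec.add <| Exec.sub ?_
    refine ⟨(h₁.update le_rfl _).update (by omega) _, ?_, ?_, ?_⟩
    · simp [h₁.tmp, h₂]; ring
    · simp [h₃, h₄]; omega
    · simp [h₄]
  · refine ⟨(((Agree.refl _ s).update le_rfl _).update (by omega) _).update (by omega) _, ?_, ?_, ?_⟩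
    · simp
    · simp [hm]
    · simp
  · refine ⟨(h.1.mono (by omega)).update le_rfl _, ?_⟩
    simp [h.2.1]

/-- Computes the address of an array entry. -/
def address (k j i i' : ℕ) : Program :=
  .seq (.const (3 * k + 10) j) <|
  .seq (mulSize k) <|
  .seq (.add (3 * k + 10) (3 * k + 10) (3 * i + 9)) <|
  .seq (mulSize k) <|
  .add (3 * k + 10) (3 * k + 10) (3 * i' + 9)

theorem exec_address {m n : ℕ} {σ : Store m} (k j i i' : ℕ) {s : State} (h : Represents n σ s) :
    Exec (address k j i i') s (6 * m + 13) fun s' =>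
      Agree k s s' ∧ s'.reg (3 * k + 10) = (j * m + σ.idx i) * m + σ.idx i' := by
  unfold address
  refine Exec.mono (Exec.seq <| Exec.const <| Exec.seq <|
    (exec_mulSize (m := m) k _ ?_).mono le_rfl fun s₁ h₁ => Exec.seq <| Exec.add <| Exec.seq <|
      (exec_mulSize (m := m) k _ ?_).mono le_rfl fun s₂ h₂ => Exec.add ?_)
    (B := 1 + ((3 * m + 5) + (1 + ((3 * m + 5) + 1)))) (by omega) fun s' h => h
  · exact (h.update_tmp k j).size
  · exact (((h.update_tmp k j).agree h₁.1).update_tmp k _).size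
  · have a₁ := ((Agree.refl k s).update le_rfl j).trans h₁.1
    have a₂ := (a₁.update le_rfl _).trans h₂.1
    refine ⟨a₂.update le_rfl _, ?_⟩
    have e₁ := (h.agree a₁).idx i
    have e₂ := (h.agree a₂).idx i'
    simp [h₂.2, h₁.2, e₁, e₂]

namespace PolyExpr

variable {E E' C : ∀ m : ℕ, ℕ → Store m → ℕ}

theorem lit (c : ℕ) : PolyExpr fun _ _ _ => c := fun k =>
  ⟨.const (3 * k + 10) c, 1, fun m n σ s _ => by
    simpa using Exec.const ⟨(Agree.refl k s).update le_rfl _, by simp⟩⟩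

theorem of_reg (r : ℕ) (h : ∀ m n (σ : Store m) s, Represents n σ s → s.reg r = E m n σ) :
    PolyExpr E := fun k =>
  ⟨.copy (3 * k + 10) r, 1, fun m n σ s hs => by
    simpa using Exec.copy ⟨(Agree.refl k s).update le_rfl _, by simp [h m n σ s hs]⟩⟩

theorem size : PolyExpr fun m _ _ => m := of_reg 0 fun _ _ _ _ h => h.size

theorem bound : PolyExpr fun _ n _ => n := of_reg 1 fun _ _ _ _ h => h.bound

theorem val (i : ℕ) : PolyExpr fun _ _ σ => σ.val i := of_reg _ fun _ _ _ _ h => h.val i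

theorem idx (i : ℕ) : PolyExpr fun _ _ σ => (σ.idx i : ℕ) := of_reg _ fun _ _ _ _ h => h.idx i

theorem arr (j i i' : ℕ) : PolyExpr fun _ _ σ => σ.arr j (σ.idx i) (σ.idx i') := fun k =>
  ⟨.seq (address k j i i') (.load (3 * k + 10) (3 * k + 10)), 6 * Polynomial.X + 14,
    fun m n σ s hs => by
      refine Exec.mono (Exec.seq <| (exec_address k j i i' hs).mono le_rfl fun s' h =>
        Exec.load (Q := fun s' => Agree k s s' ∧
          s'.reg (3 * k + 10) = σ.arr j (σ.idx i) (σ.idx i')) ?_) ?_ fun s' h => h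
      · exact ⟨h.1.update le_rfl _, by simp [h.2, (hs.agree h.1).arr]⟩
      · simp; omega⟩

/-- The first operand waits in temporary `k` while the second is evaluated with temporaries from `k
+ 1` on. This is why `PolyExpr` demands a program for every `k`. -/
theorem map₂ {f : ℕ → ℕ → ℕ} (hE : PolyExpr E) (hE' : PolyExpr E') (p : ℕ → ℕ → ℕ → Program)
    (hp : ∀ (i j k : ℕ) (s : State) (Q : State → Prop),
      Q ⟨Function.update s.reg i (f (s.reg j) (s.reg k)), s.mem⟩ → Exec (p i j k) s 1 Q) :
    PolyExpr fun m n σ => f (E m n σ) (E' m n σ) := fun k => by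
  obtain ⟨p₁, P₁, h₁⟩ := hE k
  obtain ⟨p₂, P₂, h₂⟩ := hE' (k + 1)
  refine ⟨.seq p₁ (.seq p₂ (p (3 * k + 10) (3 * k + 10) (3 * (k + 1) + 10))), P₁ + (P₂ + 1),
    fun m n σ s hs => Exec.mono (Exec.seq <| (h₁ m n σ s hs).mono le_rfl fun s₁ q₁ =>
      Exec.seq <| (h₂ m n σ s₁ (hs.agree q₁.1)).mono le_rfl fun s₂ q₂ => hp _ _ _ _ _ ?_)
      (by simp) fun s' h => h⟩
  exact ⟨(q₁.1.trans (q₂.1.mono (by omega))).update le_rfl _, by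
    simp [q₂.2, q₂.1.tmp, q₁.2]⟩

theorem add (hE : PolyExpr E) (hE' : PolyExpr E') :
    PolyExpr fun m n σ => E m n σ + E' m n σ :=
  hE.map₂ (f := (· + ·)) hE' .add fun _ _ _ _ _ => Exec.add

theorem sub (hE : PolyExpr E) (hE' : PolyExpr E') :
    PolyExpr fun m n σ => E m n σ - E' m n σ :=
  hE.map₂ (f := (· - ·)) hE' .sub fun _ _ _ _ _ => Exec.sub

theorem ite_ne_zero (hC : PolyExpr C) (hE : PolyExpr E) (hE' : PolyExpr E') :
    PolyExpr fun m n σ => if C m n σ ≠ 0 then E m n σ else E' m n σ := fun k => by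
  obtain ⟨p₀, P₀, h₀⟩ := hC k
  obtain ⟨p₁, P₁, h₁⟩ := hE k
  obtain ⟨p₂, P₂, h₂⟩ := hE' k
  refine ⟨.seq p₀ (.branch (3 * k + 10) p₁ p₂), P₀ + (P₁ + P₂ + 1),
    fun m n σ s hs => Exec.mono (Exec.seq <| (h₀ m n σ s hs).mono le_rfl fun s₁ q₁ =>
      Exec.branch
        (fun h => (h₁ m n σ s₁ (hs.agree q₁.1)).mono le_rfl fun s₂ q₂ => ?_)
        (fun h => (h₂ m n σ s₁ (hs.agree q₁.1)).mono le_rfl fun s₂ q₂ => ?_))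
      (by simp) fun s' h => h⟩
  · rw [q₁.2] at h
    exact ⟨q₁.1.trans q₂.1, q₂.2.trans (if_pos h).symm⟩
  · rw [q₁.2] at h
    exact ⟨q₁.1.trans q₂.1, q₂.2.trans (if_neg (by simpa using h)).symm⟩

end PolyExpr

/-! ### Loops over the alternatives -/

/-- Runs `p` for all values of the `i`-th index, counted by the `k`-th temporary value. -/
def forIdx (k i : ℕ) (p : Program) : Program :=
  .seq (.const (3 * k + 10) 0) <|
  .seq (.copy (3 * (k + 1) + 10) 0) <|
  .loop (3 * (k + 1) + 10) <|
    .seq (.copy (3 * i + 9) (3 * k + 10)) <|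
    .seq p <|
    .seq (.const (3 * (k + 1) + 10) 1) <|
    .seq (.add (3 * k + 10) (3 * k + 10) (3 * (k + 1) + 10)) <|
    .sub (3 * (k + 1) + 10) 0 (3 * k + 10)

/-- Only temporary `k`, the current index, must survive the body. Temporary `k + 1` first provides
the constant 1 and is then recomputed as the number of remaining rounds. By `hInv` the invariant is
insensitive to both. -/
theorem exec_forIdx {m k i B : ℕ} {p : Program} {s : State} (Inv : ℕ → State → Prop)
    (hm : ∀ x s, Inv x s → s.reg 0 = m)
    (hInv : ∀ x s c c', Inv x s →
      Inv x ⟨Function.update (Function.update s.reg (3 * k + 10) c) (3 * (k + 1) + 10) c', s.mem⟩)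
    (hp : ∀ (x : Fin m) s, Inv x s → s.reg (3 * k + 10) = x →
      Exec p ⟨Function.update s.reg (3 * i + 9) x, s.mem⟩ B fun s' =>
        Inv (x + 1) s' ∧ s'.reg (3 * k + 10) = x)
    (h₀ : Inv 0 s) : Exec (forIdx k i p) s (m * (B + 5) + 3) (Inv m) := by
  unfold forIdx
  refine Exec.mono (Exec.seq <| Exec.const <| Exec.seq <| Exec.copy <|
    Exec.loop (N := m) (B := 1 + (B + (1 + (1 + 1)))) (fun x s' => Inv x s' ∧
      s'.reg (3 * k + 10) = x ∧ s'.reg (3 * (k + 1) + 10) = m - x) ?_ ?_ ?_)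
    (B := 1 + (1 + (m * (1 + (B + (1 + (1 + 1))) + 1) + 1))) ?_ fun s' h => h.1
  · exact fun x _ s' h => h.2.2
  · rintro x hx s' ⟨h₁, h₂, h₃⟩
    refine Exec.seq <| Exec.copy <| Exec.seq <| Exec.mono (B := B) (B' := B)
      (Q := fun s' => Inv (x + 1) s' ∧ s'.reg (3 * k + 10) = x) ?_ le_rfl
      fun s'' q => Exec.seq <| Exec.const <| Exec.seq <| Exec.add <| Exec.sub ?_
    · have := hp ⟨x, hx⟩ s' h₁ h₂
      rw [h₂]
      exact this
    · have e := hm _ _ q.1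
      have hne : 3 * (k + 1) + 10 ≠ 3 * k + 10 := by omega
      have hb₀ : 3 * (k + 1) + 10 ≠ 0 := by omega
      have ha₀ : 3 * k + 10 ≠ 0 := by omega
      generalize 3 * (k + 1) + 10 = b at *
      obtain ⟨q₁, q₂⟩ := q
      generalize 3 * k + 10 = a at *
      have := hInv _ _ (x + 1) (m - (x + 1)) q₁
      refine ⟨?_, ?_, ?_⟩
      · convert this using 2
        funext r
        by_cases hb : r = b <;> by_cases ha : r = a <;>
          simp [ha, hb, q₂, hne.symm, ha₀.symm, hb₀.symm, e]
      · simp [q₂, hne.symm]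
      · simp [q₂, hne.symm, ha₀.symm, hb₀.symm, e]
  · have e := hm _ _ h₀
    have := hInv _ _ 0 m h₀
    refine ⟨?_, by simp, by simp [e]⟩
    simpa [e] using this
  · have : 1 + (B + (1 + (1 + 1))) + 1 = B + 5 := by omega
    rw [this]
    omega

theorem sum_ite_val_lt_succ {m : ℕ} (f : Fin m → ℕ) (x : Fin m) :
    (∑ z : Fin m, if (z : ℕ) < x + 1 then f z else 0) =
      (∑ z : Fin m, if (z : ℕ) < x then f z else 0) + f x := by
  have : f x = ∑ z : Fin m, if z = x then f z else 0 := by simp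
  rw [this, ← Finset.sum_add_distrib]
  refine Finset.sum_congr rfl fun z _ => ?_
  simp only [Fin.ext_iff]
  split_ifs <;> omega

theorem PolyExpr.sum {E : ∀ m : ℕ, ℕ → Store m → ℕ} (i : ℕ) (hE : PolyExpr E) :
    PolyExpr fun m n σ => ∑ x : Fin m, E m n (σ.setIdx i x) := fun k => by
  -- Temporaries `k` to `k + 3` hold the partial sum, the saved value of the bound index and the two
  -- loop counters.
  obtain ⟨p, P, h⟩ := hE (k + 4)
  refine ⟨.seq (.const (3 * k + 10) 0) <| .seq (.copy (3 * (k + 1) + 10) (3 * i + 9)) <|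
    .seq (forIdx (k + 2) i (.seq p (.add (3 * k + 10) (3 * k + 10) (3 * (k + 4) + 10)))) <|
    .copy (3 * i + 9) (3 * (k + 1) + 10), Polynomial.X * (P + 6) + 6, fun m n σ s hs => ?_⟩
  refine Exec.mono (Exec.seq <| Exec.const <| Exec.seq <| Exec.copy <| Exec.seq <|
    (exec_forIdx (m := m) (B := P.eval (m + n) + 1) (fun x s' => s'.mem = s.mem ∧
      (∀ r, (∀ l, k ≤ l → r ≠ 3 * l + 10) → r ≠ 3 * i + 9 → s'.reg r = s.reg r) ∧
      s'.reg (3 * (k + 1) + 10) = σ.idx i ∧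
      s'.reg (3 * k + 10) = ∑ z : Fin m, if (z : ℕ) < x then E m n (σ.setIdx i z) else 0)
      ?_ ?_ ?_ ?_).mono le_rfl fun s' q => Exec.copy ?_)
    (B := 1 + (1 + (m * (P.eval (m + n) + 6) + 3 + 1))) ?_ fun s' h => h
  · intro x s' q
    rw [q.2.1 0 (by omega) (by omega), hs.size]
  · rintro x s' c c' ⟨q₁, q₂, q₃, q₄⟩
    refine ⟨q₁, fun r hr hi => ?_, ?_, ?_⟩ <;> dsimp only
    · rw [Function.update_of_ne (hr _ (by omega)), Function.update_of_ne (hr _ (by omega)),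
        q₂ r hr hi]
    · rw [Function.update_of_ne (by omega), Function.update_of_ne (by omega), q₃]
    · rw [Function.update_of_ne (by omega), Function.update_of_ne (by omega), q₄]
  · rintro x s' ⟨q₁, q₂, q₃, q₄⟩ hx
    have hr : Represents n (σ.setIdx i x) ⟨Function.update s'.reg (3 * i + 9) x, s'.mem⟩ := by
      refine (hs.update_idx i x).agree (k := k) ⟨q₁, fun r hr => ?_⟩
      by_cases hi : r = 3 * i + 9
      · simp [hi]
      · simp [hi, q₂ r hr hi]
    refine Exec.seq ((h m n _ _ hr).mono le_rfl fun s₁ a => Exec.add ?_)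
    have ht : ∀ l < k + 4, s₁.reg (3 * l + 10) = s'.reg (3 * l + 10) := fun l hl =>
      (a.1.tmp hl).trans (Function.update_of_ne (by omega) ..)
    refine ⟨⟨a.1.mem.trans q₁, fun r hr hi => ?_, ?_, ?_⟩, ?_⟩ <;> dsimp only
    · have := a.1.reg r fun l hl => hr l (by omega)
      dsimp only at this
      rw [Function.update_of_ne hi] at this
      rw [Function.update_of_ne (hr _ le_rfl), this, q₂ r hr hi]
    · rw [Function.update_of_ne (by omega), ht _ (by omega), q₃]
    · rw [Function.update_self, ht _ (by omega), q₄, a.2, sum_ite_val_lt_succ]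
    · rw [Function.update_of_ne (by omega), ht _ (by omega), hx]
  · refine ⟨rfl, fun r hr hi => ?_, ?_, ?_⟩
    · simp only
      rw [Function.update_of_ne (hr _ (by omega)), Function.update_of_ne (hr _ (by omega))]
    · simp only
      rw [Function.update_self, Function.update_of_ne (by omega), hs.idx]
    · simp
  · obtain ⟨q₁, q₂, q₃, q₄⟩ := q
    refine ⟨⟨q₁, fun r hr => ?_⟩, ?_⟩
    · simp only
      by_cases hi : r = 3 * i + 9
      · rw [hi, Function.update_self, q₃, hs.idx]
      · rw [Function.update_of_ne hi, q₂ r hr hi]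
    · simp only
      rw [Function.update_of_ne (by omega), q₄]
      exact Finset.sum_congr rfl fun z _ => if_pos z.2
  · simp only [Polynomial.eval_add, Polynomial.eval_mul, Polynomial.eval_X, Polynomial.eval_ofNat]
    have : m * (P.eval (m + n) + 6) ≤ (m + n) * (P.eval (m + n) + 6) :=
      Nat.mul_le_mul_right _ (by omega)
    omega

namespace Store

variable {m : ℕ}

@[simp] theorem setIdx_setIdx (σ : Store m) (i : ℕ) (x y : Fin m) :
    (σ.setIdx i x).setIdx i y = σ.setIdx i y := by
  simp [setIdx]

@[simp] theorem setIdx_self (σ : Store m) (i : ℕ) : σ.setIdx i (σ.idx i) = σ := by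
  simp [setIdx]

end Store

namespace PolyImpl

variable {F F' : ∀ m : ℕ, ℕ → Store m → Store m} {E C : ∀ m : ℕ, ℕ → Store m → ℕ}

theorem id : PolyImpl fun _ _ σ => σ := fun k =>
  ⟨.const (3 * k + 10) 0, 1, fun m n σ s hs => by
    simpa using Exec.const ⟨hs.update_tmp k 0, fun l hl => Function.update_of_ne (by omega) ..⟩⟩

theorem comp (hF' : PolyImpl F') (hF : PolyImpl F) :
    PolyImpl fun m n σ => F' m n (F m n σ) := fun k => by
  obtain ⟨p, P, h⟩ := hF k
  obtain ⟨p', P', h'⟩ := hF' k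
  exact ⟨.seq p p', P + P', fun m n σ s hs => Exec.mono (Exec.seq <|
    (h m n σ s hs).mono le_rfl fun s₁ q₁ => (h' m n _ s₁ q₁.1).mono le_rfl fun s₂ q₂ =>
      ⟨q₂.1, fun l hl => (q₂.2 l hl).trans (q₁.2 l hl)⟩) (by simp) fun _ h => h⟩

theorem setVal (i : ℕ) (hE : PolyExpr E) : PolyImpl fun m n σ => σ.setVal i (E m n σ) :=
  fun k => by
  obtain ⟨p, P, h⟩ := hE k
  refine ⟨.seq p (.copy (3 * i + 8) (3 * k + 10)), P + 1, fun m n σ s hs => Exec.mono (Exec.seq <|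
    (h m n σ s hs).mono le_rfl fun s₁ q₁ => Exec.copy ?_) (by simp) fun _ h => h⟩
  rw [q₁.2]
  exact ⟨(hs.agree q₁.1).update_val i _, fun l hl => by
    simp only
    rw [Function.update_of_ne (by omega), q₁.1.tmp hl]⟩

theorem setIdx (i i' : ℕ) : PolyImpl fun _ _ σ => σ.setIdx i (σ.idx i') := fun k =>
  ⟨.copy (3 * i + 9) (3 * i' + 9), 1, fun m n σ s hs => by
    have := Exec.copy (s := s) (i := 3 * i + 9) (j := 3 * i' + 9)
      (Q := fun s' => Represents n (σ.setIdx i (σ.idx i')) s' ∧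
        ∀ l < k, s'.reg (3 * l + 10) = s.reg (3 * l + 10))
      ⟨by rw [hs.idx]; exact hs.update_idx i _, fun l hl => Function.update_of_ne (by omega) ..⟩
    simpa using this⟩

theorem setCell (j i i' : ℕ) (hE : PolyExpr E) :
    PolyImpl fun m n σ => σ.setArr j fun x y =>
      if x = σ.idx i ∧ y = σ.idx i' then E m n σ else σ.arr j x y := fun k => by
  obtain ⟨p, P, h⟩ := hE k
  refine ⟨.seq p (.seq (address (k + 1) j i i') (.store (3 * (k + 1) + 10) (3 * k + 10))),
    P + (6 * Polynomial.X + 14), fun m n σ s hs => Exec.mono (Exec.seq <|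
    (h m n σ s hs).mono le_rfl fun s₁ q₁ => Exec.seq <|
    (exec_address (k + 1) j i i' (hs.agree q₁.1)).mono le_rfl fun s₂ q₂ => Exec.store ?_)
    (by simp; omega) fun _ h => h⟩
  have a := q₁.1.trans (q₂.1.mono (by omega))
  refine ⟨?_, fun l hl => a.tmp hl⟩
  rw [q₂.2, q₂.1.tmp (by omega), q₁.2]
  exact (hs.agree a).update_arr ..

theorem ite_ne_zero (hC : PolyExpr C) (hF : PolyImpl F) (hF' : PolyImpl F') :
    PolyImpl fun m n σ => if C m n σ ≠ 0 then F m n σ else F' m n σ := fun k => by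
  obtain ⟨p₀, P₀, h₀⟩ := hC k
  obtain ⟨p₁, P₁, h₁⟩ := hF k
  obtain ⟨p₂, P₂, h₂⟩ := hF' k
  refine ⟨.seq p₀ (.branch (3 * k + 10) p₁ p₂), P₀ + (P₁ + P₂ + 1),
    fun m n σ s hs => Exec.mono (Exec.seq <| (h₀ m n σ s hs).mono le_rfl fun s₁ q₁ =>
      Exec.branch
        (fun h => (h₁ m n σ s₁ (hs.agree q₁.1)).mono le_rfl fun s₂ q₂ => ?_)
        (fun h => (h₂ m n σ s₁ (hs.agree q₁.1)).mono le_rfl fun s₂ q₂ => ?_))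
      (by simp) fun s' h => h⟩
  · rw [q₁.2] at h
    simp only [if_pos h]
    exact ⟨q₂.1, fun l hl => (q₂.2 l hl).trans (q₁.1.tmp hl)⟩
  · rw [q₁.2] at h
    simp only [h, ne_eq, not_true_eq_false, if_false]
    exact ⟨q₂.1, fun l hl => (q₂.2 l hl).trans (q₁.1.tmp hl)⟩

/-- A single loop runs at most `m + n` times; higher polynomial numbers of rounds arise by nesting.
-/
theorem iterate_reg (r : ℕ) (N : ℕ → ℕ → ℕ) (hN : ∀ m n, N m n ≤ m + n)
    (hr : ∀ m n (σ : Store m) s, Represents n σ s → s.reg r = N m n) (hF : PolyImpl F) :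
    PolyImpl fun m n σ => (F m n)^[N m n] σ := fun k => by
  obtain ⟨p, P, h⟩ := hF (k + 1)
  refine ⟨.seq (.copy (3 * k + 10) r) <| .loop (3 * k + 10) <| .seq p <|
    .seq (.const (3 * (k + 1) + 10) 1) <| .sub (3 * k + 10) (3 * k + 10) (3 * (k + 1) + 10),
    Polynomial.X * (P + 3) + 2, fun m n σ s hs => ?_⟩
  refine Exec.mono (Exec.seq <| Exec.copy <| Exec.loop (N := N m n)
    (B := P.eval (m + n) + (1 + 1)) (fun i s' => Represents n ((F m n)^[i] σ) s' ∧
      (∀ l < k, s'.reg (3 * l + 10) = s.reg (3 * l + 10)) ∧ s'.reg (3 * k + 10) = N m n - i)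
      ?_ ?_ ?_) ?_ fun s' q => ⟨q.1, q.2.1⟩
  · exact fun i _ s' q => q.2.2
  · rintro i hi s' ⟨q₁, q₂, q₃⟩
    refine Exec.seq <| (h m n _ _ q₁).mono le_rfl fun s₁ a => Exec.seq <| Exec.const <|
      Exec.sub ⟨?_, ?_, ?_⟩
    · rw [Function.iterate_succ_apply']
      exact (a.1.update_tmp _ _).update_tmp _ _
    · intro l hl
      simp only
      rw [Function.update_of_ne (by omega), Function.update_of_ne (by omega), a.2 l (by omega),
        q₂ l hl]
    · simp [a.2 k (by omega), q₃]
      omega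
  · refine ⟨hs.update_tmp _ _, fun l hl => Function.update_of_ne (by omega) .., ?_⟩
    simp [hr m n σ s hs]
  · simp only [Polynomial.eval_add, Polynomial.eval_mul, Polynomial.eval_X, Polynomial.eval_ofNat]
    have : N m n * (P.eval (m + n) + 3) ≤ (m + n) * (P.eval (m + n) + 3) :=
      Nat.mul_le_mul_right _ (hN m n)
    have : P.eval (m + n) + (1 + 1) + 1 = P.eval (m + n) + 3 := by omega
    rw [this]
    omega

theorem iterate_size (hF : PolyImpl F) : PolyImpl fun m n σ => (F m n)^[m] σ :=
  iterate_reg 0 (fun m _ => m) (fun _ _ => by omega) (fun _ _ _ _ h => h.size) hF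

theorem iterate_bound (hF : PolyImpl F) : PolyImpl fun m n σ => (F m n)^[n] σ :=
  iterate_reg 1 (fun _ n => n) (fun _ _ => by omega) (fun _ _ _ _ h => h.bound) hF

/-- `G m n σ x` is a closed form for the store after `x` rounds with the `i`-th index reset to its
initial value, so the loop variable is local. -/
theorem forIdx (i : ℕ) (hF : PolyImpl F) (G : ∀ m : ℕ, ℕ → Store m → ℕ → Store m)
    (h₀ : ∀ m n σ, G m n σ 0 = σ)
    (hG : ∀ m n σ (x : Fin m),
      (F m n ((G m n σ x).setIdx i x)).setIdx i (σ.idx i) = G m n σ (x + 1)) :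
    PolyImpl fun m n σ => G m n σ m := fun k => by
  obtain ⟨p, P, h⟩ := hF (k + 3)
  refine ⟨.seq (.copy (3 * k + 10) (3 * i + 9)) <| .seq (RAM.forIdx (k + 1) i p) <|
    .copy (3 * i + 9) (3 * k + 10), Polynomial.X * (P + 5) + 5, fun m n σ s hs => ?_⟩
  refine Exec.mono (Exec.seq <| Exec.copy <| Exec.seq <|
    (exec_forIdx (m := m) (B := P.eval (m + n)) (fun x s' =>
      (∃ τ : Store m, τ.setIdx i (σ.idx i) = G m n σ x ∧ Represents n τ s') ∧
      (∀ l < k, s'.reg (3 * l + 10) = s.reg (3 * l + 10)) ∧ s'.reg (3 * k + 10) = σ.idx i)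
      ?_ ?_ ?_ ?_).mono le_rfl fun s' q => Exec.copy ?_)
    (B := 1 + (m * (P.eval (m + n) + 5) + 3 + 1)) ?_ fun s' h => h
  · rintro x s' ⟨⟨τ, -, hτ⟩, -⟩
    exact hτ.size
  · rintro x s' c c' ⟨⟨τ, e, hτ⟩, q₁, q₂⟩
    refine ⟨⟨τ, e, (hτ.update_tmp _ _).update_tmp _ _⟩, fun l hl => ?_, ?_⟩ <;> dsimp only
    · rw [Function.update_of_ne (by omega), Function.update_of_ne (by omega), q₁ l hl]
    · rw [Function.update_of_ne (by omega), Function.update_of_ne (by omega), q₂]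
  · rintro x s' ⟨⟨τ, e, hτ⟩, q₁, q₂⟩ hx
    refine (h m n _ _ (hτ.update_idx i x)).mono le_rfl fun s₁ a => ⟨⟨⟨_, ?_, a.1⟩, ?_, ?_⟩, ?_⟩
    · rw [← hG, ← e, Store.setIdx_setIdx]
    · intro l hl
      rw [a.2 l (by omega), ← q₁ l hl]
      exact Function.update_of_ne (by omega) ..
    · rw [a.2 k (by omega), ← q₂]
      exact Function.update_of_ne (by omega) ..
    · rw [a.2 (k + 1) (by omega), ← hx]
      exact Function.update_of_ne (by omega) ..
  · refine ⟨⟨σ, by rw [h₀, Store.setIdx_self], hs.update_tmp _ _⟩,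
      fun l hl => Function.update_of_ne (by omega) .., ?_⟩
    simp [hs.idx]
  · obtain ⟨⟨τ, e, hτ⟩, q₁, q₂⟩ := q
    refine ⟨?_, fun l hl => ?_⟩
    · dsimp only
      rw [q₂, ← e]
      exact hτ.update_idx i _
    · rw [← q₁ l hl]
      exact Function.update_of_ne (by omega) ..
  · simp only [Polynomial.eval_add, Polynomial.eval_mul, Polynomial.eval_X, Polynomial.eval_ofNat]
    have : m * (P.eval (m + n) + 5) ≤ (m + n) * (P.eval (m + n) + 5) :=
      Nat.mul_le_mul_right _ (by omega)
    omega

end PolyImpl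

end RAM

/-! Minimum cuts by moving a single unit of flow along a labelling. -/

namespace TokenFlow

open Finset

variable {V : Type*} [Fintype V]

/-- The invariant of a flow from `s` to `t` with capacities `cap`: the residual capacities are `r`,
the labels are `d`, one unit of excess is at `u`, and `D` units have been delivered to `t`. -/
structure Invariant [DecidableEq V] (cap : V → V → ℕ) (s t : V) (r : V → V → ℕ) (d : V → ℕ) (u : V)
    (D : ℕ) : Prop where
  symm : ∀ x z, r x z + r z x = cap x z + cap z x
  excess : ∀ x, x ≠ s →
    ∑ z, r x z = ∑ z, cap x z + (if x = u then 1 else 0) + (if x = t then D else 0)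
  valid : ∀ x z, 0 < r x z → d x ≤ d z + 1
  sink : d t = 0
  le_card : ∀ x, d x ≤ Fintype.card V

variable [DecidableEq V]

/-- The residual capacities after moving one unit from `u` to `z`. -/
def push (r : V → V → ℕ) (u z : V) : V → V → ℕ := fun x y =>
  if x = u ∧ y = z then r x y - 1 else if x = z ∧ y = u then r x y + 1 else r x y

/-- The labels after raising the label of `u`. -/
def relabel (d : V → ℕ) (u : V) : V → ℕ := fun x => if x = u then d x + 1 else d x

namespace Invariant

variable {cap : V → V → ℕ} {s t : V} {r : V → V → ℕ} {d : V → ℕ} {u : V} {D : ℕ}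

theorem initial (cap : V → V → ℕ) (s t : V) : Invariant cap s t cap (fun _ => 0) s 0 where
  symm _ _ := rfl
  excess x hx := by simp [hx]
  valid _ _ _ := Nat.zero_le _
  sink := rfl
  le_card _ := Nat.zero_le _

/-- The balance at `s` is not recorded, so the delivered unit can be booked in `D` while a new one
appears at `s`. -/
theorem deliver (h : Invariant cap s t r d t D) : Invariant cap s t r d s (D + 1) where
  symm := h.symm
  excess x hx := by
    rw [h.excess x hx, if_neg hx]
    split_ifs <;> omega
  valid := h.valid
  sink := h.sink
  le_card := h.le_card

theorem sum_push_source (r : V → V → ℕ) {u z : V} (huz : u ≠ z) (hr : 0 < r u z) :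
    ∑ y, push r u z u y + 1 = ∑ y, r u y := by
  have h : ∀ y, r u y = push r u z u y + if y = z then 1 else 0 := fun y => by
    unfold push
    by_cases hy : y = z
    · subst hy; simp; omega
    · simp [hy, huz]
  simp [Finset.sum_congr rfl fun y _ => h y, Finset.sum_add_distrib]

theorem sum_push_target (r : V → V → ℕ) {u z : V} (huz : u ≠ z) :
    ∑ y, push r u z z y = ∑ y, r z y + 1 := by
  have h : ∀ y, push r u z z y = r z y + if y = u then 1 else 0 := fun y => by
    unfold push
    by_cases hy : y = u
    · subst hy; simp [huz.symm]
    · simp [hy, huz.symm]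
  simp [h, Finset.sum_add_distrib]

theorem sum_push_other (r : V → V → ℕ) {u z x : V} (hu : x ≠ u) (hz : x ≠ z) :
    ∑ y, push r u z x y = ∑ y, r x y := by
  simp [push, hu, hz]

theorem push (h : Invariant cap s t r d u D) {z : V} (hr : 0 < r u z) (hd : d z < d u) :
    Invariant cap s t (TokenFlow.push r u z) d z D where
  symm x y := by
    have huz : u ≠ z := by rintro rfl; omega
    have e := h.symm x y
    unfold TokenFlow.push
    by_cases h₁ : x = u ∧ y = z
    · obtain ⟨rfl, rfl⟩ := h₁
      simp [huz, huz.symm]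
      omega
    · by_cases h₂ : x = z ∧ y = u
      · obtain ⟨rfl, rfl⟩ := h₂
        simp [huz, huz.symm]
        omega
      · rw [if_neg h₁, if_neg h₂, if_neg (by tauto), if_neg (by tauto), e]
  excess x hx := by
    have huz : u ≠ z := by rintro rfl; omega
    have e := h.excess x hx
    by_cases h₁ : x = u
    · subst h₁
      have := sum_push_source r huz hr
      rw [if_pos rfl] at e
      rw [if_neg huz]
      omega
    · by_cases h₂ : x = z
      · subst h₂
        rw [sum_push_target r huz, e, if_neg h₁, if_pos rfl]
        omega
      · rw [sum_push_other r h₁ h₂, e, if_neg h₁, if_neg h₂]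
  valid x y hxy := by
    unfold TokenFlow.push at hxy
    split_ifs at hxy with h₁ h₂
    · exact h.valid x y (by omega)
    -- The only arc that can become residual is the reverse of the one just used; it leads uphill.
    · obtain ⟨rfl, rfl⟩ := h₂
      omega
    · exact h.valid x y hxy
  sink := h.sink
  le_card := h.le_card

theorem relabel (h : Invariant cap s t r d u D) (hut : u ≠ t)
    (hd : ∀ z, 0 < r u z → d u ≤ d z) (hu : d u < Fintype.card V) :
    Invariant cap s t r (TokenFlow.relabel d u) u D where
  symm := h.symm
  excess := h.excess
  valid x z hxz := by
    have := h.valid x z hxz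
    unfold TokenFlow.relabel
    split_ifs with h₁ h₂ h₂
    · omega
    · subst h₁
      have := hd z hxz
      omega
    · omega
    · omega
  sink := by simp [TokenFlow.relabel, hut.symm, h.sink]
  le_card x := by
    unfold TokenFlow.relabel
    split_ifs with h₁
    · subst h₁; omega
    · exact h.le_card x

/-- The flow through a cut. -/
theorem sum_cut (h : Invariant cap s t r d u D) (S : Finset V) (hs : s ∉ S) :
    ∑ z ∈ S, ∑ x ∈ Sᶜ, r z x =
      ∑ z ∈ S, ∑ x ∈ Sᶜ, cap z x + (if u ∈ S then 1 else 0) + if t ∈ S then D else 0 := by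
  have h₁ : ∑ z ∈ S, ∑ x, r z x =
      ∑ z ∈ S, ∑ x, cap z x + (if u ∈ S then 1 else 0) + if t ∈ S then D else 0 := by
    rw [Finset.sum_congr rfl fun z hz => h.excess z (by rintro rfl; exact hs hz)]
    simp [Finset.sum_add_distrib]
  have h₂ : ∀ f : V → V → ℕ, ∑ z ∈ S, ∑ x, f z x =
      ∑ z ∈ S, ∑ x ∈ S, f z x + ∑ z ∈ S, ∑ x ∈ Sᶜ, f z x := fun f => by
    rw [← Finset.sum_add_distrib]
    exact Finset.sum_congr rfl fun z _ => (Finset.sum_add_sum_compl S _).symm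
  -- Inside `S` every pair occurs in both orders, so by `symm` the residual capacities and the
  -- capacities have the same total there and cancel.
  have h₃ : ∀ f : V → V → ℕ, 2 * ∑ z ∈ S, ∑ x ∈ S, f z x =
      ∑ z ∈ S, ∑ x ∈ S, (f z x + f x z) := fun f => by
    simp only [Finset.sum_add_distrib]
    rw [Finset.sum_comm (f := fun z x => f x z)]
    omega
  have h₄ := h₃ r
  rw [Finset.sum_congr rfl fun z _ => Finset.sum_congr rfl fun x _ => h.symm z x, ← h₃ cap] at h₄
  rw [h₂ r, h₂ cap] at h₁
  omega

/-- Weak duality: every cut has capacity at least `D`, with equality if it contains the token and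
has no outgoing residual capacity. It follows by applying `sum_cut` to the complement and adding up
`symm` across the cut. -/
theorem cut_eq (h : Invariant cap s t r d u D) {A : Finset V} (hs : s ∈ A) (ht : t ∉ A) :
    ∑ x ∈ A, ∑ z ∈ Aᶜ, cap x z =
      ∑ x ∈ A, ∑ z ∈ Aᶜ, r x z + D + if u ∈ A then 0 else 1 := by
  have h₁ := h.sum_cut Aᶜ (by simpa using hs)
  rw [compl_compl] at h₁
  have h₂ : ∀ f : V → V → ℕ, ∑ x ∈ A, ∑ z ∈ Aᶜ, f x z + ∑ z ∈ Aᶜ, ∑ x ∈ A, f z x =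
      ∑ x ∈ A, ∑ z ∈ Aᶜ, (f x z + f z x) := fun f => by
    simp only [Finset.sum_add_distrib]
    rw [Finset.sum_comm (s := Aᶜ)]
  have h₃ := h₂ r
  rw [Finset.sum_congr rfl fun z _ => Finset.sum_congr rfl fun x _ => h.symm z x, ← h₂ cap] at h₃
  rw [if_pos (mem_compl.2 ht)] at h₁
  by_cases hu : u ∈ A <;> simp only [mem_compl, hu, not_true_eq_false, not_false_eq_true,
    if_true, if_false] at h₁ ⊢ <;> omega

/-- When the label of the token has reached the number of vertices, some set of vertices with large
labels is a minimum cut. -/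
theorem exists_minimum_cut (h : Invariant cap s t r d u D) (hu : Fintype.card V ≤ d u) :
    ∃ k < Fintype.card V, k < d s ∧ ∀ A : Finset V, s ∈ A → t ∉ A →
      ∑ x ∈ univ.filter (k < d ·), ∑ z ∈ (univ.filter (k < d ·))ᶜ, cap x z ≤
        ∑ x ∈ A, ∑ z ∈ Aᶜ, cap x z := by
  -- Pigeonhole: the label of `u` is not below the number of vertices, so the other vertices cannot
  -- realise all smaller values.
  obtain ⟨k, hk, hgap⟩ : ∃ k < Fintype.card V, ∀ x, d x ≠ k := by
    by_contra! H
    have h₁ : range (Fintype.card V) ⊆ (univ.erase u).image d := fun k hk => by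
      obtain ⟨x, hx⟩ := H k (mem_range.1 hk)
      refine mem_image.2 ⟨x, mem_erase.2 ⟨?_, mem_univ _⟩, hx⟩
      rintro rfl
      have := mem_range.1 hk
      omega
    have h₂ := (card_le_card h₁).trans card_image_le
    rw [card_range, card_erase_of_mem (mem_univ u), card_univ] at h₂
    have := Fintype.card_pos_iff.2 ⟨u⟩
    omega
  set A := univ.filter (k < d ·) with hA
  -- A residual arc descends by at most one level and so cannot jump over the gap.
  have hr : ∀ x ∈ A, ∀ z ∈ Aᶜ, r x z = 0 := fun x hx z hz => by
    simp only [hA, mem_compl, mem_filter, mem_univ, true_and] at hx hz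
    by_contra hne
    have := h.valid x z (by omega)
    have := hgap z
    omega
  have hr' : ∑ x ∈ A, ∑ z ∈ Aᶜ, r x z = 0 :=
    sum_eq_zero fun x hx => sum_eq_zero fun z hz => hr x hx z hz
  have huA : u ∈ A := by simp [hA]; omega
  have htA : t ∉ A := by simp [hA, h.sink]
  -- Without `s`, the set would hold the excess unit at `u`, which forces positive residual capacity
  -- out of it.
  have hsA : s ∈ A := by
    by_contra hs
    have := h.sum_cut A hs
    rw [hr', if_pos huA] at this
    omega
  refine ⟨k, hk, by simpa [hA] using hsA, fun B hs ht => ?_⟩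
  rw [h.cut_eq hsA htA, h.cut_eq hs ht, hr', if_pos huA]
  omega

/-- A quantity that grows in every step. -/
def potential (d : V → ℕ) (u : V) (D : ℕ) : ℕ :=
  -- The last summand rewards descending. It can drop by the number of vertices on a delivery, and
  -- drops by one when a label is raised; the factors of `D` and of the sum outweigh these losses.
  D * (Fintype.card V + 1) + 2 * ∑ x, d x + (Fintype.card V - d u)

theorem potential_deliver (h : Invariant cap s t r d t D) :
    potential d t D < potential d s (D + 1) := by
  have := h.le_card s
  unfold potential
  rw [h.sink, Nat.succ_mul D]
  omega

theorem potential_push (h : Invariant cap s t r d u D) {z : V} (hd : d z < d u) :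
    potential d u D < potential d z D := by
  have := h.le_card u
  unfold potential
  omega

theorem potential_relabel (hu : d u < Fintype.card V) :
    potential d u D < potential (TokenFlow.relabel d u) u D := by
  have h₁ : ∑ x, TokenFlow.relabel d u x = ∑ x, d x + 1 := by
    have : ∀ x, TokenFlow.relabel d u x = d x + if x = u then 1 else 0 := fun x => by
      unfold TokenFlow.relabel
      split_ifs <;> rfl
    simp [this, sum_add_distrib]
  have h₂ : TokenFlow.relabel d u u = d u + 1 := by simp [TokenFlow.relabel]
  unfold potential
  rw [h₁, h₂]
  omega

theorem potential_le (h : Invariant cap s t r d u D) (hst : s ≠ t) {n : ℕ}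
    (hcap : ∀ x z, cap x z ≤ n) :
    potential d u D ≤ Fintype.card V * n * (Fintype.card V + 1) +
      2 * (Fintype.card V * Fintype.card V) + Fintype.card V := by
  -- The deliveries are bounded by the capacity into `t`.
  have hD : D ≤ Fintype.card V * n := by
    have h₁ := h.excess t hst.symm
    have h₂ : ∑ z, r t z ≤ ∑ z, (cap t z + cap z t) :=
      sum_le_sum fun z _ => by
        have := h.symm t z
        omega
    have h₃ : ∑ z, cap z t ≤ ∑ _z : V, n := sum_le_sum fun z _ => hcap z t
    rw [sum_const, card_univ, smul_eq_mul] at h₃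
    rw [sum_add_distrib] at h₂
    rw [if_pos rfl] at h₁
    omega
  have hd : ∑ x, d x ≤ Fintype.card V * Fintype.card V := by
    have := sum_le_sum fun x (_ : x ∈ univ) => h.le_card x
    simpa using this
  unfold potential
  have := Nat.mul_le_mul_right (Fintype.card V + 1) hD
  omega

end Invariant

end TokenFlow

/-! ### Split Cycle losers and cuts -/

namespace WeightedTournament

variable {V : Type*} {n : ℕ}

theorem margin_eq (T : WeightedTournament V n) {x y : V} (h : x ≠ y) :
    T.margin x y = 2 * T.w x y - n := by
  have := T.add_eq x y h
  unfold margin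
  omega

theorem DominanceCycle.splittingNumber_le {T : WeightedTournament V n} (C : T.DominanceCycle)
    (i : Fin C.len) : C.splittingNumber ≤ T.margin (C.vert i.castSucc) (C.vert i.succ) :=
  Finset.inf'_le _ (Finset.mem_univ i)

/-- A closed sequence that enters a set leaves it. -/
theorem DominanceCycle.exists_leaving {T : WeightedTournament V n} (C : T.DominanceCycle)
    (A : Set V) {i : Fin C.len} (h₁ : C.vert i.castSucc ∉ A) (h₂ : C.vert i.succ ∈ A) :
    ∃ j : Fin C.len, C.vert j.castSucc ∈ A ∧ C.vert j.succ ∉ A := by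
  by_contra! H
  have key : ∀ (j k : Fin (C.len + 1)), j ≤ k → C.vert j ∈ A → C.vert k ∈ A := by
    intro j k
    induction k using Fin.induction with
    | zero =>
      intro h hj
      obtain rfl : j = 0 := by simpa using h
      exact hj
    | succ k ih =>
      intro h hj
      rcases h.eq_or_lt with rfl | h
      · exact hj
      · exact H k (ih (Fin.le_castSucc_iff.2 h) hj)
  -- If no edge leaves `A`, membership propagates to the end, passes to the start because the
  -- sequence is closed, and reaches the tail of the entering edge.
  have h₃ := key _ _ (Fin.le_last i.succ) h₂
  rw [← C.closed] at h₃
  exact h₁ (key _ _ (Fin.zero_le _) h₃)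

/-- An alternative is dominated if all strong enough paths from it miss one of its predecessors. -/
theorem notMem_splitCycle_of_cut (T : WeightedTournament V n) {a y : V} {v : ℕ} {A : Set V}
    (hya : y ≠ a) (hv : n < 2 * v) (ha : a ∈ A) (hy : y ∉ A) (hw : v ≤ T.w y a)
    (hA : ∀ x ∈ A, ∀ z ∉ A, T.w x z < v) : a ∉ T.splitCycle := by
  intro h
  have hm := T.margin_eq hya
  refine h y ⟨⟨hya, by omega⟩, ?_⟩
  rintro C ⟨i, hi, hs⟩
  obtain ⟨hi₁, hi₂⟩ := Prod.mk.inj hi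
  rw [← hi₁, ← hi₂] at hs
  -- A cycle through `(y, a)` enters `A` and must leave it, along an edge of smaller margin; so `(y,
  -- a)` does not split it.
  obtain ⟨j, hj₁, hj₂⟩ := C.exists_leaving A (hi₁ ▸ hy) (hi₂ ▸ ha)
  have h₁ := C.splittingNumber_le j
  have h₂ := hA _ hj₁ _ hj₂
  have hne : C.vert j.castSucc ≠ C.vert j.succ := fun e => hj₂ (e ▸ hj₁)
  rw [T.margin_eq hne] at h₁
  omega

theorem _root_.Relation.ReflTransGen.exists_seq {α : Type*} {r : α → α → Prop} {a b : α}
    (h : Relation.ReflTransGen r a b) :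
    ∃ (l : ℕ) (f : ℕ → α), f 0 = a ∧ f l = b ∧ ∀ i < l, r (f i) (f (i + 1)) := by
  induction h with
  | refl => exact ⟨0, fun _ => a, rfl, rfl, by simp⟩
  | @tail b c _ hbc ih =>
    obtain ⟨l, f, h₀, h₁, h₂⟩ := ih
    refine ⟨l + 1, fun i => if i ≤ l then f i else c, by simpa, by simp, fun i hi => ?_⟩
    rcases Nat.lt_or_ge i l with h | h
    · simpa [h.le, Nat.succ_le_iff.2 h] using h₂ i h
    · obtain rfl : i = l := by omega
      simpa [h₁] using hbc

/-- If an alternative is not a winner, then a cut witnesses this. -/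
theorem exists_cut_of_notMem_splitCycle (T : WeightedTournament V n) {a : V}
    (h : a ∉ T.splitCycle) :
    ∃ (y : V) (A : Set V), y ≠ a ∧ n < 2 * T.w y a ∧ a ∈ A ∧ y ∉ A ∧
      ∀ x ∈ A, ∀ z ∉ A, T.w x z < T.w y a := by
  obtain ⟨y, ⟨hya, hm⟩, hC⟩ : ∃ y, T.deletedMarginGraph.Adj y a := by
    simpa [splitCycle] using h
  have hw := T.margin_eq hya
  refine ⟨y, {x | Relation.ReflTransGen (fun x z => T.margin y a ≤ T.margin x z) a x}, hya,
    by omega, .refl, fun hy => ?_, fun x hx z hz => ?_⟩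
  -- If `y` were reachable, the path preceded by `y` would be a dominance cycle with `(y, a)` among
  -- its weakest edges.
  · obtain ⟨l, f, h₀, h₁, h₂⟩ := hy.exists_seq
    have hle : ∀ i : Fin (l + 1), T.margin y a ≤
        T.margin (Fin.cons (α := fun _ => V) y (fun i : Fin (l + 1) => f i) i.castSucc)
          (Fin.cons (α := fun _ => V) y (fun i : Fin (l + 1) => f i) i.succ) := by
      intro i
      induction i using Fin.cases with
      | zero => simp [h₀]
      | succ i =>
        rw [← Fin.succ_castSucc]
        simpa using h₂ i i.2
    let C : T.DominanceCycle :=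
      { len := l + 1
        len_pos := Nat.succ_pos l
        vert := Fin.cons y fun i => f i
        closed := by rw [← Fin.succ_last]; simp [h₁]
        margin_pos := fun i => hm.trans_le (hle i) }
    refine hC C ⟨0, ?_, ?_⟩
    · simp [C, h₀]
    · refine le_antisymm ?_ (C.splittingNumber_le 0)
      refine Finset.le_inf' _ _ fun i _ => ?_
      simpa [C, h₀] using hle i
  · have hxz : x ≠ z := by rintro rfl; exact hz hx
    have h₁ : ¬ T.margin y a ≤ T.margin x z := fun h => hz (.tail hx h)
    rw [T.margin_eq hxz] at h₁
    omega

theorem Reversal.size_eq [Fintype V] {T : WeightedTournament V n} (R : T.Reversal) :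
    R.size = ∑ p, ∑ q, max (R.R p q) 0 := by
  rw [← Fintype.sum_prod_type', Reversal.size, Finset.sum_filter]
  refine Finset.sum_congr rfl fun p _ => ?_
  split_ifs with h
  · rw [max_eq_left h.le]
  · rw [max_eq_right (not_lt.1 h)]

/-! ### Reversal functions given by cuts -/

variable [DecidableEq V]

/-- The positive values of the cheapest reversal function that raises the weight of `(y, a)` to at
least `v` and lowers all weights from `A` to its complement below `v`. -/
def cutReversalPos (T : WeightedTournament V n) (a y : V) (v : ℕ) (A : Finset V) (p q : V) : ℕ :=
  if p = y ∧ q = a then v - T.w y a else if q ∈ A ∧ p ∉ A then T.w q p - (v - 1) else 0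

/-- The parameters of a reversal function which makes `a` lose by means of `y`. -/
structure IsCut (n : ℕ) (a y : V) (v : ℕ) (A : Finset V) : Prop where
  ne : y ≠ a
  lt : n < 2 * v
  le : v ≤ n
  mem : a ∈ A
  notMem : y ∉ A

section

variable {T : WeightedTournament V n} {a y : V} {v : ℕ} {A : Finset V}

/-- Positive entries lead only from the complement into `A`, so they never compete with an entry of
the opposite pair and really are the positive part of an antisymmetric function. -/
theorem IsCut.cutReversalPos_eq_zero (h : IsCut n a y v A) {p q : V} (hp : p ∈ A ∨ q ∉ A) :
    T.cutReversalPos a y v A p q = 0 := by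
  unfold cutReversalPos
  rw [if_neg, if_neg]
  · tauto
  · rintro ⟨rfl, rfl⟩
    exact hp.elim h.notMem fun h' => h' h.mem

theorem IsCut.cutReversalPos_le (h : IsCut n a y v A) (p q : V) :
    T.cutReversalPos a y v A p q ≤ T.w q p := by
  have h₁ := h.lt
  unfold cutReversalPos
  split_ifs with h₂
  · obtain ⟨rfl, rfl⟩ := h₂
    have := T.add_eq p q h.ne
    have := h.le
    omega
  · omega
  · omega

theorem IsCut.cutReversalPos_add_le (h : IsCut n a y v A) (p q : V) :
    T.w p q + T.cutReversalPos a y v A p q ≤ n := by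
  by_cases hpq : p = q
  · subst hpq
    rw [h.cutReversalPos_eq_zero (by tauto)]
    exact T.le_n p p
  · have := h.cutReversalPos_le (T := T) p q
    have := T.add_eq p q hpq
    omega

theorem IsCut.cutReversalPos_swap (h : IsCut n a y v A) (p q : V) :
    T.cutReversalPos a y v A p q = 0 ∨ T.cutReversalPos a y v A q p = 0 := by
  by_cases hp : p ∈ A
  · exact .inl (h.cutReversalPos_eq_zero (.inl hp))
  · exact .inr (h.cutReversalPos_eq_zero (.inr hp))

variable (T) in
/-- The reversal function with positive part `cutReversalPos`. -/
def cutReversal (h : IsCut n a y v A) : T.Reversal where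
  R p q := (T.cutReversalPos a y v A p q : ℤ) - T.cutReversalPos a y v A q p
  mem_range p q := by
    have := h.cutReversalPos_le (T := T) p q
    have := h.cutReversalPos_le (T := T) q p
    have := T.le_n p q
    have := T.le_n q p
    omega
  antisymm p q := by omega
  nonneg p q := by
    have := h.cutReversalPos_le (T := T) q p
    omega
  le_n p q := by
    have := h.cutReversalPos_add_le (T := T) p q
    omega

theorem max_cutReversal (h : IsCut n a y v A) (p q : V) :
    max ((T.cutReversal h).R p q) 0 = T.cutReversalPos a y v A p q := by
  have := h.cutReversalPos_swap (T := T) p q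
  simp only [cutReversal]
  omega

theorem size_cutReversal [Fintype V] (h : IsCut n a y v A) :
    (T.cutReversal h).size = ((∑ p, ∑ q, T.cutReversalPos a y v A p q : ℕ) : ℤ) := by
  rw [Reversal.size_eq]
  simp only [max_cutReversal]
  push_cast
  rfl

/-- The pair `(a, y)` leaves `A` but is not lowered on its own account: once `(y, a)` has weight at
least `v`, it has weight at most `n - v`, which is below `v`. -/
theorem isWDRS_cutReversal (h : IsCut n a y v A) (ha : a ∈ T.splitCycle) :
    IsWDRS splitCycle T a (T.cutReversal h) := by
  have h₁ := h.lt
  refine ⟨ha, notMem_splitCycle_of_cut _ (A := A) h.ne h.lt (by simpa using h.mem)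
    (by simpa using h.notMem) ?_ fun x hx z hz => ?_⟩
  · have h₂ : T.cutReversalPos a y v A a y = 0 := h.cutReversalPos_eq_zero (.inl h.mem)
    have h₃ : T.cutReversalPos a y v A y a = v - T.w y a := by simp [cutReversalPos]
    simp only [reverse, cutReversal, h₂, h₃]
    omega
  · have hxz : T.cutReversalPos a y v A x z = 0 :=
      h.cutReversalPos_eq_zero (.inl (by simpa using hx))
    have hzx : T.w x z < v + T.cutReversalPos a y v A z x := by
      unfold cutReversalPos
      split_ifs with h₂ h₃
      · obtain ⟨rfl, rfl⟩ := h₂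
        have := T.add_eq z x h.ne
        omega
      · omega
      · exact absurd ⟨by simpa using hx, by simpa using hz⟩ h₃
    simp only [reverse, cutReversal, hxz]
    omega

/-- Every weighted destructive reversal set is at least as large as one given by a cut. -/
theorem IsWDRS.exists_cut [Fintype V] {R : T.Reversal} (hR : IsWDRS splitCycle T a R) :
    ∃ (y : V) (v : ℕ) (A : Finset V), IsCut n a y v A ∧
      ((∑ p, ∑ q, T.cutReversalPos a y v A p q : ℕ) : ℤ) ≤ R.size := by
  classical
  obtain ⟨y, A, hya, hlt, ha, hy, hA⟩ := exists_cut_of_notMem_splitCycle _ hR.2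
  refine ⟨y, (T.reverse R).w y a, A.toFinset, ⟨hya, hlt, (T.reverse R).le_n _ _, by simpa,
    by simpa⟩, ?_⟩
  rw [Reversal.size_eq]
  push_cast
  -- With `v` the new weight of `(y, a)`, the comparison holds entry by entry: each pair must be
  -- changed by at least the amount that the cut demands.
  refine Finset.sum_le_sum fun p _ => Finset.sum_le_sum fun q _ => ?_
  unfold cutReversalPos
  split_ifs with h₁ h₂
  · obtain ⟨rfl, rfl⟩ := h₁
    have := R.nonneg p q
    simp only [reverse]
    omega
  · have h₃ := hA q (by simpa using h₂.1) p (by simpa using h₂.2)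
    have h₄ := R.nonneg q p
    have h₅ := R.antisymm q p
    simp only [reverse] at h₃ ⊢
    omega
  · simp

/-- The capacities whose cuts are the costs of reversal functions. -/
def cutCapacity (T : WeightedTournament V n) (a y : V) (v : ℕ) (x z : V) : ℕ :=
  if x = a ∧ z = y then 0 else T.w x z - (v - 1)

/-- The entry at `(p, q)` is paid by the arc `(q, p)` out of `A`. The entry at `(y, a)` is accounted
for separately, which is why the arc `(a, y)` has capacity 0. -/
theorem sum_cutReversalPos [Fintype V] (h : IsCut n a y v A) :
    ∑ p, ∑ q, T.cutReversalPos a y v A p q =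
      (v - T.w y a) + ∑ x ∈ A, ∑ z ∈ Aᶜ, T.cutCapacity a y v x z := by
  have e : ∀ p q, T.cutReversalPos a y v A p q = (if p = y then if q = a then v - T.w y a else 0
      else 0) + if q ∈ A then if p ∈ Aᶜ then T.cutCapacity a y v q p else 0 else 0 := by
    intro p q
    unfold cutReversalPos cutCapacity
    by_cases h₁ : p = y <;> by_cases h₂ : q = a <;> simp [h₁, h₂, h.mem, h.notMem, ite_and]
  simp only [e, Finset.sum_add_distrib]
  congr 1
  · simp
  · rw [Finset.sum_comm]
    simp only [Finset.sum_ite_mem, Finset.univ_inter, Finset.sum_ite_irrel, Finset.sum_const_zero]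

end

end WeightedTournament

/-! ### Polynomial-time tests and array assignments -/

namespace RAM

theorem _root_.List.take_succ_finRange {m : ℕ} (x : Fin m) :
    (List.finRange m).take (x + 1) = (List.finRange m).take x ++ [x] := by
  rw [List.take_add_one, List.getElem?_eq_getElem (by simp)]
  simp

namespace Store

variable {m : ℕ}

theorem setArr_setIdx (σ : Store m) (j i : ℕ) (f : Fin m → Fin m → ℕ) (x : Fin m) :
    (σ.setArr j f).setIdx i x = (σ.setIdx i x).setArr j f := rfl

theorem setArr_setArr (σ : Store m) (j : ℕ) (f g : Fin m → Fin m → ℕ) :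
    (σ.setArr j f).setArr j g = σ.setArr j g := by
  simp [setArr]

@[simp] theorem setArr_self (σ : Store m) (j : ℕ) : σ.setArr j (σ.arr j) = σ := by
  simp [setArr]

end Store

/-- The condition `c` on the store can be tested in polynomial time. -/
def PolyPred (c : ∀ m : ℕ, ℕ → Store m → Prop) : Prop :=
  ∃ E, PolyExpr E ∧ ∀ m n σ, E m n σ ≠ 0 ↔ c m n σ

section

variable {c c' : ∀ m : ℕ, ℕ → Store m → Prop} {E E' : ∀ m : ℕ, ℕ → Store m → ℕ}
  {F F' : ∀ m : ℕ, ℕ → Store m → Store m}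

theorem PolyExpr.ite [∀ m n σ, Decidable (c m n σ)] (hc : PolyPred c) (hE : PolyExpr E)
    (hE' : PolyExpr E') : PolyExpr fun m n σ => if c m n σ then E m n σ else E' m n σ := by
  obtain ⟨C, hC, h⟩ := hc
  simpa only [h] using hC.ite_ne_zero hE hE'

theorem PolyImpl.ite [∀ m n σ, Decidable (c m n σ)] (hc : PolyPred c) (hF : PolyImpl F)
    (hF' : PolyImpl F') : PolyImpl fun m n σ => if c m n σ then F m n σ else F' m n σ := by
  obtain ⟨C, hC, h⟩ := hc
  simpa only [h] using hF.ite_ne_zero hC hF'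

theorem PolyExpr.congr (hE : PolyExpr E) (h : ∀ m n σ, E m n σ = E' m n σ) : PolyExpr E' := by
  obtain rfl : E = E' := by funext m n σ; exact h m n σ
  exact hE

theorem PolyImpl.congr (hF : PolyImpl F) (h : ∀ m n σ, F m n σ = F' m n σ) : PolyImpl F' := by
  obtain rfl : F = F' := by funext m n σ; exact h m n σ
  exact hF

namespace PolyPred

theorem lt (hE : PolyExpr E) (hE' : PolyExpr E') : PolyPred fun m n σ => E m n σ < E' m n σ :=
  ⟨_, hE'.sub hE, fun _ _ _ => by omega⟩

theorem not (hc : PolyPred c) : PolyPred fun m n σ => ¬ c m n σ := by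
  obtain ⟨C, hC, h⟩ := hc
  exact ⟨_, (PolyExpr.lit 1).sub hC, fun m n σ => by
    simp only [← h]
    omega⟩

theorem and (hc : PolyPred c) (hc' : PolyPred c') : PolyPred fun m n σ => c m n σ ∧ c' m n σ := by
  obtain ⟨C, hC, h⟩ := hc
  obtain ⟨C', hC', h'⟩ := hc'
  exact ⟨_, hC.ite_ne_zero hC' (.lit 0), fun m n σ => by
    simp only [← h, ← h']
    split_ifs <;> tauto⟩

theorem or (hc : PolyPred c) (hc' : PolyPred c') : PolyPred fun m n σ => c m n σ ∨ c' m n σ := by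
  simpa only [not_and_or, not_not] using (hc.not.and hc'.not).not

theorem le (hE : PolyExpr E) (hE' : PolyExpr E') : PolyPred fun m n σ => E m n σ ≤ E' m n σ := by
  simpa only [not_lt] using (lt hE' hE).not

theorem eq (hE : PolyExpr E) (hE' : PolyExpr E') : PolyPred fun m n σ => E m n σ = E' m n σ := by
  simpa only [le_antisymm_iff] using (le hE hE').and (le hE' hE)

theorem idx_eq (i i' : ℕ) : PolyPred fun _ _ σ => σ.idx i = σ.idx i' := by
  simpa only [Fin.ext_iff] using eq (.idx i) (.idx i')

end PolyPred

namespace PolyImpl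

/-- By `hloc`, the new value of a cell depends on array `j` only through that cell. Overwriting in
place, cell by cell, therefore agrees with a simultaneous assignment. -/
theorem setArr_row (j i i' : ℕ) (hii' : i ≠ i') (hE : PolyExpr E)
    (hloc : ∀ m n (σ : Store m) f, f (σ.idx i) (σ.idx i') = σ.arr j (σ.idx i) (σ.idx i') →
      E m n (σ.setArr j f) = E m n σ) :
    PolyImpl fun m n σ => σ.setArr j fun x y =>
      if x = σ.idx i then E m n (σ.setIdx i' y) else σ.arr j x y := by
  refine ((setCell j i i' hE).forIdx i' (fun m n σ c => σ.setArr j fun x y =>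
    if x = σ.idx i ∧ y < c then E m n (σ.setIdx i' y) else σ.arr j x y) ?_ ?_).congr ?_
  · intro m n σ
    simp
  · intro m n σ x
    have e : E m n ((σ.setArr j fun x' y => if x' = σ.idx i ∧ (y : ℕ) < x then
        E m n (σ.setIdx i' y) else σ.arr j x' y).setIdx i' x) = E m n (σ.setIdx i' x) :=
      hloc m n (σ.setIdx i' x) _ (by simp)
    rw [e]
    simp only [Store.setArr_setIdx, Store.setArr_setArr, Store.setIdx_setIdx, Store.setIdx_self]
    congr 1
    funext x' y'
    simp only [Store.idx_setIdx, Store.idx_setArr, Store.arr_setIdx, Store.arr_setArr, if_true,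
      if_neg hii']
    rcases eq_or_ne y' x with rfl | hy
    · by_cases hx : x' = σ.idx i <;> simp [hx]
    · have : ((y' : ℕ) < x ↔ (y' : ℕ) < x + 1) := by
        have := Fin.val_ne_of_ne hy
        omega
      simp [hy, this]
  · intro m n σ
    simp

theorem setArr (j i i' : ℕ) (hii' : i ≠ i') (hE : PolyExpr E)
    (hloc : ∀ m n (σ : Store m) f, f (σ.idx i) (σ.idx i') = σ.arr j (σ.idx i) (σ.idx i') →
      E m n (σ.setArr j f) = E m n σ) :
    PolyImpl fun m n σ => σ.setArr j fun x y => E m n ((σ.setIdx i x).setIdx i' y) := by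
  refine ((setArr_row j i i' hii' hE hloc).forIdx i (fun m n σ c => σ.setArr j fun x y =>
    if x < c then E m n ((σ.setIdx i x).setIdx i' y) else σ.arr j x y) ?_ ?_).congr ?_
  · intro m n σ
    simp
  · intro m n σ x
    have e : ∀ y, E m n (((σ.setArr j fun x' y => if (x' : ℕ) < x then
        E m n ((σ.setIdx i x').setIdx i' y) else σ.arr j x' y).setIdx i x).setIdx i' y) =
        E m n ((σ.setIdx i x).setIdx i' y) := fun y =>
      hloc m n ((σ.setIdx i x).setIdx i' y) _ (by simp [hii'])
    simp only [e]
    simp only [Store.setArr_setIdx, Store.setArr_setArr, Store.setIdx_setIdx, Store.setIdx_self]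
    congr 1
    funext x' y'
    simp only [Store.arr_setIdx, Store.arr_setArr, if_true]
    rcases eq_or_ne x' x with rfl | hx
    · simp
    · have : ((x' : ℕ) < x ↔ (x' : ℕ) < x + 1) := by
        have := Fin.val_ne_of_ne hx
        omega
      simp [hx, this]
  · intro m n σ
    simp

theorem foldl (i : ℕ) (hF : PolyImpl F) : PolyImpl fun m n σ =>
    (List.finRange m).foldl (fun τ x => (F m n (τ.setIdx i x)).setIdx i (σ.idx i)) σ := by
  refine (hF.forIdx i (fun m n σ c => ((List.finRange m).take c).foldl
    (fun τ x => (F m n (τ.setIdx i x)).setIdx i (σ.idx i)) σ) (fun m n σ => rfl)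
    fun m n σ x => ?_).congr fun m n σ => ?_
  · simp [List.take_succ_finRange]
  · simp [List.take_of_length_le]

end PolyImpl

end

end RAM

/-! The algorithm. Its store holds the weights, the residual capacities, the labels (on the
diagonal), the candidate and the best reversal function found so far in the arrays `0` to `4`; the
winner `a`, its opponent `y`, the position of the token and its next position in the indices `0`
to `3`; the threshold `v`, the level `k` and the successor of the best size found so far (or `0`)
in the values `0` to `2`. The indices `5` and `6` are bound variables. -/

namespace RAM

namespace MinReversal

open WeightedTournament

variable {m : ℕ}

def initFlow (σ : Store m) : Store m :=
  ((σ.setArr 1 fun x z => if x = σ.idx 0 ∧ z = σ.idx 1 then 0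
    else σ.arr 0 x z - (σ.val 0 - 1)).setArr 2 fun _ _ => 0).setIdx 2 (σ.idx 0)

def Admissible (σ : Store m) (z : Fin m) : Prop :=
  0 < σ.arr 1 (σ.idx 2) z ∧ σ.arr 2 z z < σ.arr 2 (σ.idx 2) (σ.idx 2)

instance (σ : Store m) : DecidablePred (Admissible σ) := fun _ => instDecidableAnd

/-- If no vertex is admissible, the old index remains; `advance` therefore tests admissibility
again. -/
def findNext (σ : Store m) : Store m :=
  σ.setIdx 3 ((List.finRange m).foldl (fun w z => if Admissible σ z then z else w) (σ.idx 3))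

/-- Raising a label raises its whole row of array 2; only the diagonal entry is ever read. -/
def advance (σ : Store m) : Store m :=
  if Admissible σ (σ.idx 3) then
    (σ.setArr 1 (TokenFlow.push (σ.arr 1) (σ.idx 2) (σ.idx 3))).setIdx 2 (σ.idx 3)
  else σ.setArr 2 fun x y => if x = σ.idx 2 then σ.arr 2 x y + 1 else σ.arr 2 x y

def step (σ : Store m) : Store m :=
  if σ.idx 2 = σ.idx 1 then σ.setIdx 2 (σ.idx 0)
  else if m ≤ σ.arr 2 (σ.idx 2) (σ.idx 2) then σ
  else advance (findNext σ)

/-- The number of rounds is an upper bound. Surplus rounds do nothing, since `step` fixes the store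
once the label of the token has reached `m`. -/
def flow (n : ℕ) (σ : Store m) : Store m := step^[n * m * m * m * m * m] (initFlow σ)

def buildCandidate (σ : Store m) : Store m :=
  σ.setArr 3 fun p q => if p = σ.idx 1 ∧ q = σ.idx 0 then σ.val 0 - σ.arr 0 p q
    else if σ.val 1 < σ.arr 2 q q ∧ ¬ σ.val 1 < σ.arr 2 p p then σ.arr 0 q p - (σ.val 0 - 1) else 0

def candidateSize (σ : Store m) : ℕ := ∑ p, ∑ q, σ.arr 3 p q

def Improves (n : ℕ) (σ : Store m) : Prop :=
  (¬ σ.idx 1 = σ.idx 0 ∧ n < σ.val 0 + σ.val 0 ∧ σ.val 0 ≤ n ∧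
    σ.val 1 < σ.arr 2 (σ.idx 0) (σ.idx 0) ∧ ¬ σ.val 1 < σ.arr 2 (σ.idx 1) (σ.idx 1)) ∧
  (σ.val 2 = 0 ∨ candidateSize σ + 1 < σ.val 2)

instance (n : ℕ) (σ : Store m) : Decidable (Improves n σ) := instDecidableAnd

def keepCandidate (n : ℕ) (σ : Store m) : Store m :=
  if Improves n σ then (σ.setVal 2 (candidateSize σ + 1)).setArr 4 (σ.arr 3) else σ

def tryLevel (n : ℕ) (σ : Store m) : Store m :=
  let τ := keepCandidate n (buildCandidate σ)
  τ.setVal 1 (τ.val 1 + 1)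

/-- The gap in the labels is not computed. All levels below `m` are tried: each level that passes
the test `Improves` gives a valid reversal function, and the gap level gives an optimal one. -/
def tryLevels (n : ℕ) (σ : Store m) : Store m := (tryLevel n)^[m] (σ.setVal 1 0)

def tryThreshold (n : ℕ) (σ : Store m) : Store m :=
  tryLevels n (flow n (σ.setVal 0 (σ.val 0 + 1)))

def tryOpponent (n : ℕ) (σ : Store m) : Store m := (tryThreshold n)^[n] (σ.setVal 0 0)

def tryAll (n : ℕ) (σ : Store m) : Store m :=
  (List.finRange m).foldl (fun τ y => (tryOpponent n (τ.setIdx 1 y)).setIdx 1 (σ.idx 1)) σ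

def main (n : ℕ) (σ : Store m) : Store m :=
  let τ := tryAll n σ
  (τ.setVal 2 (τ.val 2 - 1)).setArr 0 (τ.arr 4)

/-! ### Running time of the algorithm -/

theorem polyImpl_initFlow : PolyImpl fun _ _ σ => initFlow σ := by
  refine (PolyImpl.comp (.setIdx 2 0) <| .comp
    (.setArr 2 5 6 (by omega) (.lit 0) fun _ _ _ _ _ => rfl)
    (.setArr 1 5 6 (by omega) (.ite (.and (.idx_eq 5 0) (.idx_eq 6 1)) (.lit 0)
      (.sub (.arr 0 5 6) (.sub (.val 0) (.lit 1)))) ?_)).congr ?_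
  · intros; simp
  · intro m n σ
    simp [initFlow]

theorem polyPred_admissible (i : ℕ) : PolyPred fun _ _ σ => Admissible σ (σ.idx i) :=
  .and (.lt (.lit 0) (.arr 1 2 i)) (.lt (.arr 2 i i) (.arr 2 2 2))

theorem polyImpl_findNext : PolyImpl fun _ _ σ => findNext σ := by
  refine ((PolyImpl.ite (polyPred_admissible 5) (.setIdx 3 5) .id).forIdx 5
    (fun m n σ c => σ.setIdx 3 (((List.finRange m).take c).foldl
      (fun w z => if Admissible σ z then z else w) (σ.idx 3))) ?_ ?_).congr ?_
  · intro m n σ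
    simp
  · intro m n σ x
    simp only [List.take_succ_finRange, List.foldl_append, List.foldl_cons, List.foldl_nil]
    generalize ((List.finRange m).take x).foldl
      (fun w z => if Admissible σ z then z else w) (σ.idx 3) = w
    have e : Admissible ((σ.setIdx 3 w).setIdx 5 x) x ↔ Admissible σ x := by simp [Admissible]
    have e' : ((σ.setIdx 3 w).setIdx 5 x).idx 5 = x := by simp
    simp only [e', e]
    split_ifs <;> ext i <;> simp only [Store.idx_setIdx, Store.val_setIdx, Store.arr_setIdx] <;>
      split_ifs <;> simp_all
  · intro m n σ
    simp [findNext, List.take_of_length_le]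

theorem polyImpl_advance : PolyImpl fun _ _ σ => advance σ := by
  refine PolyImpl.congr (.ite (polyPred_admissible 3) (.comp (.setIdx 2 3)
    (.setArr 1 5 6 (by omega) (.ite (.and (.idx_eq 5 2) (.idx_eq 6 3))
      (.sub (.arr 1 5 6) (.lit 1)) (.ite (.and (.idx_eq 5 3) (.idx_eq 6 2))
      (.add (.arr 1 5 6) (.lit 1)) (.arr 1 5 6))) ?_))
    (.setArr 2 5 6 (by omega) (.ite (.idx_eq 5 2) (.add (.arr 2 5 6) (.lit 1)) (.arr 2 5 6)) ?_)) ?_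
  · intro m n σ f h; simp [h]
  · intro m n σ f h; simp [h]
  · intro m n σ
    rfl

theorem polyImpl_step : PolyImpl fun _ _ σ => step σ :=
  .ite (.idx_eq 2 1) (.setIdx 2 0) <| .ite (.le .size (.arr 2 2 2)) .id <|
    .comp polyImpl_advance polyImpl_findNext

theorem polyImpl_flow : PolyImpl fun _ n σ => flow n σ := by
  refine (PolyImpl.comp (PolyImpl.iterate_size <| .iterate_size <| .iterate_size <| .iterate_size <|
    .iterate_size <| .iterate_bound polyImpl_step) polyImpl_initFlow).congr fun m n σ => ?_
  simp only [flow, Function.iterate_mul]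

theorem polyImpl_buildCandidate : PolyImpl fun _ _ σ => buildCandidate σ := by
  refine (PolyImpl.setArr 3 5 6 (by omega) (.ite (.and (.idx_eq 5 1) (.idx_eq 6 0))
    (.sub (.val 0) (.arr 0 5 6)) (.ite (.and (.lt (.val 1) (.arr 2 6 6))
      (.not (.lt (.val 1) (.arr 2 5 5)))) (.sub (.arr 0 6 5) (.sub (.val 0) (.lit 1)))
      (.lit 0))) ?_).congr ?_
  · intro m n σ f h; simp
  · intro m n σ
    simp [buildCandidate]

theorem polyExpr_candidateSize : PolyExpr fun _ _ σ => candidateSize σ :=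
  ((PolyExpr.sum 5 (PolyExpr.sum 6 (.arr 3 5 6)))).congr fun m n σ => by
    simp [candidateSize]

theorem polyPred_improves : PolyPred fun _ n σ => Improves n σ :=
  .and (.and (.not (.idx_eq 1 0)) <| .and (.lt .bound (.add (.val 0) (.val 0))) <|
    .and (.le (.val 0) .bound) <| .and (.lt (.val 1) (.arr 2 0 0))
      (.not (.lt (.val 1) (.arr 2 1 1))))
    (.or (.eq (.val 2) (.lit 0)) (.lt (.add polyExpr_candidateSize (.lit 1)) (.val 2)))

theorem polyImpl_copyArr (j j' : ℕ) : PolyImpl fun _ _ σ => σ.setArr j (σ.arr j') := by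
  by_cases h : j = j'
  · exact PolyImpl.id.congr fun m n σ => by simp [h]
  · refine (PolyImpl.setArr j 5 6 (by omega) (.arr j' 5 6) ?_).congr ?_
    · intro m n σ f _; simp [Ne.symm h]
    · intro m n σ; simp

theorem polyImpl_keepCandidate : PolyImpl fun _ n σ => keepCandidate n σ :=
  .ite polyPred_improves (.comp (polyImpl_copyArr 4 3)
    (.setVal 2 (.add polyExpr_candidateSize (.lit 1)))) .id

theorem polyImpl_tryLevel : PolyImpl fun _ n σ => tryLevel n σ :=
  (PolyImpl.comp (.setVal 1 (.add (.val 1) (.lit 1)))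
    (.comp polyImpl_keepCandidate polyImpl_buildCandidate)).congr fun _ _ _ => rfl

theorem polyImpl_tryLevels : PolyImpl fun _ n σ => tryLevels n σ :=
  (PolyImpl.comp (.iterate_size polyImpl_tryLevel) (.setVal 1 (.lit 0))).congr fun _ _ _ => rfl

theorem polyImpl_tryThreshold : PolyImpl fun _ n σ => tryThreshold n σ :=
  (PolyImpl.comp polyImpl_tryLevels
    (.comp polyImpl_flow (.setVal 0 (.add (.val 0) (.lit 1))))).congr fun _ _ _ => rfl

theorem polyImpl_tryOpponent : PolyImpl fun _ n σ => tryOpponent n σ :=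
  (PolyImpl.comp (.iterate_bound polyImpl_tryThreshold) (.setVal 0 (.lit 0))).congr
    fun _ _ _ => rfl

theorem polyImpl_main : PolyImpl fun _ n σ => main n σ :=
  (PolyImpl.comp (.comp (polyImpl_copyArr 0 4) (.setVal 2 (.sub (.val 2) (.lit 1))))
    (.foldl 1 polyImpl_tryOpponent)).congr fun _ _ _ => rfl

end MinReversal

end RAM

/-! ### Correctness of the algorithm -/

namespace RAM

namespace MinReversal

open WeightedTournament

variable {m n : ℕ}

theorem foldl_ite_of_exists {α : Type*} {p : α → Prop} [DecidablePred p] (l : List α) (w : α)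
    (h : (∃ z ∈ l, p z) ∨ p w) : p (l.foldl (fun w z => if p z then z else w) w) := by
  induction l generalizing w with
  | nil => simpa using h
  | cons x l ih =>
    refine ih _ ?_
    dsimp only
    split_ifs with hx
    · exact .inr hx
    · rcases h with ⟨z, hz, hp⟩ | h
      · rcases List.mem_cons.1 hz with rfl | hz
        · exact absurd hp hx
        · exact .inl ⟨z, hz, hp⟩
      · exact .inr h

theorem admissible_findNext {σ : Store m} {z : Fin m} (h : Admissible σ z) :
    Admissible σ ((findNext σ).idx 3) := by
  simpa [findNext] using
    foldl_ite_of_exists (List.finRange m) (σ.idx 3) (.inl ⟨z, List.mem_finRange z, h⟩)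

/-- The parts of the store that the computation of a flow does not change. -/
structure Frame (σ τ : Store m) : Prop where
  val : τ.val = σ.val
  winner : τ.idx 0 = σ.idx 0
  opponent : τ.idx 1 = σ.idx 1
  weights : τ.arr 0 = σ.arr 0
  best : τ.arr 4 = σ.arr 4

theorem Frame.trans {σ τ υ : Store m} (h : Frame σ τ) (h' : Frame τ υ) : Frame σ υ :=
  ⟨h'.val.trans h.val, h'.winner.trans h.winner, h'.opponent.trans h.opponent,
    h'.weights.trans h.weights, h'.best.trans h.best⟩

theorem frame_initFlow (σ : Store m) : Frame σ (initFlow σ) := by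
  constructor <;> simp [initFlow]

theorem frame_step (σ : Store m) : Frame σ (step σ) := by
  unfold step advance
  split_ifs <;> constructor <;> simp [findNext]

theorem frame_iterate_step (i : ℕ) (σ : Store m) : Frame σ (step^[i] σ) := by
  induction i with
  | zero => exact ⟨rfl, rfl, rfl, rfl, rfl⟩
  | succ i ih =>
    rw [Function.iterate_succ_apply']
    exact ih.trans (frame_step _)

theorem frame_flow (σ : Store m) : Frame σ (flow n σ) :=
  (frame_initFlow σ).trans (frame_iterate_step _ _)

/-- The store holds a flow with `D` delivered units. -/
def FlowInvariant (cap : Fin m → Fin m → ℕ) (σ : Store m) (D : ℕ) : Prop :=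
  TokenFlow.Invariant cap (σ.idx 0) (σ.idx 1) (σ.arr 1) (fun x => σ.arr 2 x x) (σ.idx 2) D

theorem step_eq_self {cap : Fin m → Fin m → ℕ} {σ : Store m} {D : ℕ} (h : FlowInvariant cap σ D)
    (hu : m ≤ σ.arr 2 (σ.idx 2) (σ.idx 2)) : step σ = σ := by
  have hne : σ.idx 2 ≠ σ.idx 1 := fun e => by
    have := h.sink
    simp only [e] at hu this
    have := (σ.idx 1).pos
    omega
  rw [step, if_neg hne, if_pos hu]

theorem FlowInvariant.step {cap : Fin m → Fin m → ℕ} {σ : Store m} {D : ℕ}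
    (h : FlowInvariant cap σ D) (hu : ¬ m ≤ σ.arr 2 (σ.idx 2) (σ.idx 2)) :
    ∃ D', FlowInvariant cap (step σ) D' ∧
      TokenFlow.Invariant.potential (fun x => σ.arr 2 x x) (σ.idx 2) D <
      TokenFlow.Invariant.potential (fun x => (step σ).arr 2 x x) ((step σ).idx 2) D' := by
  unfold MinReversal.step FlowInvariant at *
  by_cases hut : σ.idx 2 = σ.idx 1
  · rw [if_pos hut]
    rw [hut] at h ⊢
    refine ⟨D + 1, ?_, ?_⟩
    · simpa using h.deliver
    · simpa using h.potential_deliver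
  · rw [if_neg hut, if_neg hu]
    have e : ∀ z, Admissible (findNext σ) z ↔ Admissible σ z := fun z => by
      simp [Admissible, findNext]
    unfold advance
    simp only [e]
    by_cases ha : Admissible σ ((findNext σ).idx 3)
    · rw [if_pos ha]
      refine ⟨D, ?_, ?_⟩
      · simpa [findNext] using h.push ha.1 ha.2
      · simpa [findNext] using h.potential_push ha.2
    · rw [if_neg ha]
      have hd : ∀ z, 0 < σ.arr 1 (σ.idx 2) z →
          σ.arr 2 (σ.idx 2) (σ.idx 2) ≤ σ.arr 2 z z := fun z hz => by
        by_contra hlt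
        exact ha (admissible_findNext ⟨hz, not_le.1 hlt⟩)
      have hu' : (fun x => σ.arr 2 x x) (σ.idx 2) < Fintype.card (Fin m) := by simpa using hu
      refine ⟨D, ?_, ?_⟩
      · simp only [findNext, Store.idx_setIdx, Store.arr_setIdx, Store.idx_setArr, Store.arr_setArr]
        exact h.relabel hut hd hu'
      · simp only [findNext, Store.idx_setIdx, Store.arr_setIdx, Store.idx_setArr, Store.arr_setArr]
        exact TokenFlow.Invariant.potential_relabel (d := fun x => σ.arr 2 x x) (D := D) hu'

theorem flowInvariant_initFlow (σ : Store m) :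
    FlowInvariant (fun x z => if x = σ.idx 0 ∧ z = σ.idx 1 then 0
      else σ.arr 0 x z - (σ.val 0 - 1)) (initFlow σ) 0 := by
  simpa [FlowInvariant, initFlow] using TokenFlow.Invariant.initial _ (σ.idx 0) (σ.idx 1)

theorem iterate_step {cap : Fin m → Fin m → ℕ} {σ : Store m} {D : ℕ} (h : FlowInvariant cap σ D)
    (i : ℕ) : ∃ D', FlowInvariant cap (step^[i] σ) D' ∧
      (m ≤ (step^[i] σ).arr 2 ((step^[i] σ).idx 2) ((step^[i] σ).idx 2) ∨
        i ≤ TokenFlow.Invariant.potential (fun x => (step^[i] σ).arr 2 x x)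
          ((step^[i] σ).idx 2) D') := by
  induction i with
  | zero => exact ⟨D, h, .inr (Nat.zero_le _)⟩
  | succ i ih =>
    obtain ⟨D', h', hD'⟩ := ih
    rw [Function.iterate_succ_apply']
    by_cases hu : m ≤ (step^[i] σ).arr 2 ((step^[i] σ).idx 2) ((step^[i] σ).idx 2)
    · rw [step_eq_self h' hu]
      exact ⟨D', h', .inl hu⟩
    · obtain ⟨D'', h'', hlt⟩ := h'.step hu
      exact ⟨D'', h'', .inr (by have := hD'.resolve_left hu; omega)⟩

/-- The left side is the bound of `potential_le`. The fourth power of `m` would not do: for `m = 2`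
and `n = 1` both sides would be 16. -/
theorem steps_suffice (hm : 2 ≤ m) (hn : 0 < n) :
    m * n * (m + 1) + 2 * (m * m) + m < n * m * m * m * m * m := by
  have h₂ : 8 ≤ m * m * m := Nat.mul_le_mul (Nat.mul_le_mul hm hm) hm
  have h₃ : m * m * n * 8 ≤ m * m * n * (m * m * m) := Nat.mul_le_mul_left _ h₂
  have h₄ : m * n * 1 ≤ m * n * m := Nat.mul_le_mul_left _ (by omega)
  have h₅ : m * m * 1 ≤ m * m * n := Nat.mul_le_mul_left _ hn
  have h₆ : m * 1 ≤ m * m := Nat.mul_le_mul_left _ (by omega)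
  nlinarith

/-- After the computation of the flow, some level gives a minimum cut. -/
theorem flow_spec (hm : 2 ≤ m) (hn : 0 < n) {σ : Store m} (hne : σ.idx 0 ≠ σ.idx 1)
    (hw : ∀ x z, σ.arr 0 x z ≤ n) :
    ∃ k < m, k < (flow n σ).arr 2 (σ.idx 0) (σ.idx 0) ∧
      (flow n σ).arr 2 (σ.idx 1) (σ.idx 1) = 0 ∧
      ∀ A : Finset (Fin m), σ.idx 0 ∈ A → σ.idx 1 ∉ A →
        let S := Finset.univ.filter fun x => k < (flow n σ).arr 2 x x
        let cap := fun x z : Fin m => if x = σ.idx 0 ∧ z = σ.idx 1 then 0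
          else σ.arr 0 x z - (σ.val 0 - 1)
        ∑ x ∈ S, ∑ z ∈ Sᶜ, cap x z ≤ ∑ x ∈ A, ∑ z ∈ Aᶜ, cap x z := by
  obtain ⟨D, h, hD⟩ := iterate_step (flowInvariant_initFlow σ) (n * m * m * m * m * m)
  change FlowInvariant _ (flow n σ) D at h
  have hf := frame_flow (n := n) σ
  -- Otherwise the potential would have grown in every round and exceeded its bound.
  have hu : m ≤ (flow n σ).arr 2 ((flow n σ).idx 2) ((flow n σ).idx 2) := by
    refine hD.resolve_right fun hle => ?_
    have := TokenFlow.Invariant.potential_le h (by rwa [hf.winner, hf.opponent]) (n := n)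
      fun x z => by
        have := hw x z
        split_ifs <;> omega
    rw [Fintype.card_fin] at this
    have := steps_suffice hm hn
    exact absurd (hle.trans ‹_›) (by omega)
  unfold FlowInvariant at h
  rw [hf.winner, hf.opponent] at h
  obtain ⟨k, hk, hk', hA⟩ := h.exists_minimum_cut (by simpa using hu)
  exact ⟨k, by simpa using hk, hk', h.sink, hA⟩

variable {T : WeightedTournament (Fin m) n} {a : Fin m}

/-- The best reversal function found so far is one given by a cut. -/
structure Sound (T : WeightedTournament (Fin m) n) (a : Fin m) (σ : Store m) : Prop where
  winner : σ.idx 0 = a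
  weights : σ.arr 0 = T.w
  best : σ.val 2 = 0 ∨ ∃ y v A, IsCut n a y v A ∧ σ.arr 4 = T.cutReversalPos a y v A ∧
    σ.val 2 = ∑ p, ∑ q, T.cutReversalPos a y v A p q + 1

theorem Sound.frame {σ τ : Store m} (h : Sound T a σ) (h' : Frame σ τ) : Sound T a τ where
  winner := h'.winner.trans h.winner
  weights := h'.weights.trans h.weights
  best := by rw [h'.val, h'.best]; exact h.best

/-- A reversal function of size at most `c` has been found. -/
def Found (σ : Store m) (c : ℕ) : Prop := σ.val 2 ≠ 0 ∧ σ.val 2 ≤ c + 1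

theorem frame_buildCandidate (σ : Store m) : Frame σ (buildCandidate σ) := by
  constructor <;> simp [buildCandidate]

theorem buildCandidate_spec {σ : Store m} (h : Sound T a σ) :
    (buildCandidate σ).arr 3 = T.cutReversalPos a (σ.idx 1) (σ.val 0)
      (Finset.univ.filter fun x => σ.val 1 < σ.arr 2 x x) := by
  funext p q
  by_cases hpq : p = σ.idx 1 ∧ q = a <;>
    simp [buildCandidate, cutReversalPos, h.winner, h.weights, hpq]

/-- The parts of the store that the search through the levels does not change. -/
structure LevelFrame (σ τ : Store m) : Prop where
  threshold : τ.val 0 = σ.val 0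
  opponent : τ.idx 1 = σ.idx 1
  labels : τ.arr 2 = σ.arr 2
  found : ∀ c, Found σ c → Found τ c

theorem LevelFrame.refl (σ : Store m) : LevelFrame σ σ := ⟨rfl, rfl, rfl, fun _ => id⟩

theorem LevelFrame.trans {σ τ υ : Store m} (h : LevelFrame σ τ) (h' : LevelFrame τ υ) :
    LevelFrame σ υ :=
  ⟨h'.threshold.trans h.threshold, h'.opponent.trans h.opponent, h'.labels.trans h.labels,
    fun c hc => h'.found c (h.found c hc)⟩

theorem tryLevel_spec {σ : Store m} (h : Sound T a σ) :
    Sound T a (tryLevel n σ) ∧ LevelFrame σ (tryLevel n σ) ∧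
      (tryLevel n σ).val 1 = σ.val 1 + 1 ∧
      (IsCut n a (σ.idx 1) (σ.val 0) (Finset.univ.filter fun x => σ.val 1 < σ.arr 2 x x) →
        Found (tryLevel n σ) (∑ p, ∑ q, T.cutReversalPos a (σ.idx 1) (σ.val 0)
          (Finset.univ.filter fun x => σ.val 1 < σ.arr 2 x x) p q)) := by
  have hb := buildCandidate_spec h
  have hf := frame_buildCandidate σ
  have hl : (buildCandidate σ).arr 2 = σ.arr 2 := by simp [buildCandidate]
  have hs := h.frame hf
  unfold tryLevel keepCandidate
  generalize buildCandidate σ = τ at *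
  set A := Finset.univ.filter fun x => σ.val 1 < σ.arr 2 x x with hA
  have hcut : (¬ τ.idx 1 = τ.idx 0 ∧ n < τ.val 0 + τ.val 0 ∧ τ.val 0 ≤ n ∧
      τ.val 1 < τ.arr 2 (τ.idx 0) (τ.idx 0) ∧ ¬ τ.val 1 < τ.arr 2 (τ.idx 1) (τ.idx 1)) ↔
      IsCut n a (σ.idx 1) (σ.val 0) A := by
    rw [hf.opponent, hs.winner, hf.val, hl, ← two_mul]
    constructor
    · rintro ⟨h₁, h₂, h₃, h₄, h₅⟩
      exact ⟨h₁, h₂, h₃, by simpa [hA] using h₄, by simpa [hA] using h₅⟩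
    · rintro ⟨h₁, h₂, h₃, h₄, h₅⟩
      exact ⟨h₁, h₂, h₃, by simpa [hA] using h₄, by simpa [hA] using h₅⟩
  have hsize : candidateSize τ = ∑ p, ∑ q, T.cutReversalPos a (σ.idx 1) (σ.val 0) A p q := by
    rw [candidateSize, hb]
  have hv : τ.val = σ.val := hf.val
  by_cases hi : Improves n τ
  · simp only [if_pos hi]
    refine ⟨⟨?_, ?_, .inr ⟨_, _, _, hcut.1 hi.1, ?_, ?_⟩⟩, ⟨?_, ?_, ?_, ?_⟩, ?_, fun _ => ?_⟩
    · simpa using hs.winner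
    · simpa using hs.weights
    · simpa using hb
    · simp [hsize]
    · simp [hv]
    · simpa using hf.opponent
    · simpa using hl
    · rintro c ⟨hc₁, hc₂⟩
      have := hi.2
      rw [hv] at this
      refine ⟨by simp, ?_⟩
      simp
      omega
    · simp [hv]
    · simp [Found, hsize]
  · simp only [if_neg hi]
    refine ⟨⟨?_, ?_, ?_⟩, ⟨?_, ?_, ?_, ?_⟩, ?_, fun hc => ?_⟩
    · simpa using hs.winner
    · simpa using hs.weights
    · simpa using hs.best
    · simp [hv]
    · simpa using hf.opponent
    · simpa using hl
    · rintro c hc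
      simpa [Found, hv] using hc
    · simp [hv]
    · obtain ⟨h₁, h₂⟩ := not_or.1 fun h => hi ⟨hcut.2 hc, h⟩
      rw [hsize] at h₂
      exact ⟨by simpa using h₁, by simp; omega⟩

theorem iterate_tryLevel {σ : Store m} (h : Sound T a σ) (h₀ : σ.val 1 = 0) (c : ℕ) :
    Sound T a ((tryLevel n)^[c] σ) ∧ LevelFrame σ ((tryLevel n)^[c] σ) ∧
      ((tryLevel n)^[c] σ).val 1 = c ∧
      ∀ k < c, IsCut n a (σ.idx 1) (σ.val 0) (Finset.univ.filter fun x => k < σ.arr 2 x x) →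
        Found ((tryLevel n)^[c] σ) (∑ p, ∑ q, T.cutReversalPos a (σ.idx 1) (σ.val 0)
          (Finset.univ.filter fun x => k < σ.arr 2 x x) p q) := by
  induction c with
  | zero => exact ⟨h, .refl σ, h₀, fun k hk => absurd hk (Nat.not_lt_zero k)⟩
  | succ c ih =>
    obtain ⟨h₁, h₂, h₃, h₄⟩ := ih
    rw [Function.iterate_succ_apply']
    obtain ⟨h₅, h₆, h₇, h₈⟩ := tryLevel_spec h₁
    refine ⟨h₅, h₂.trans h₆, by rw [h₇, h₃], fun k hk hc => ?_⟩
    rcases Nat.lt_succ_iff_lt_or_eq.1 hk with hk | rfl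
    · exact h₆.found _ (h₄ k hk hc)
    · rw [h₂.opponent, h₂.threshold, h₂.labels, h₃] at h₈
      exact h₈ hc

/-- For the opponent `y` and the threshold `v`, the best reversal function has been found. -/
def Optimal (T : WeightedTournament (Fin m) n) (a y : Fin m) (v : ℕ) (σ : Store m) : Prop :=
  ∀ A, IsCut n a y v A → Found σ (∑ p, ∑ q, T.cutReversalPos a y v A p q)

theorem tryThreshold_spec (hm : 2 ≤ m) (hn : 0 < n) {σ : Store m} (h : Sound T a σ) :
    Sound T a (tryThreshold n σ) ∧ (tryThreshold n σ).val 0 = σ.val 0 + 1 ∧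
      (tryThreshold n σ).idx 1 = σ.idx 1 ∧
      (∀ c, Found σ c → Found (tryThreshold n σ) c) ∧
      Optimal T a (σ.idx 1) (σ.val 0 + 1) (tryThreshold n σ) := by
  unfold tryThreshold tryLevels
  set σ₁ := σ.setVal 0 (σ.val 0 + 1) with hσ₁
  have hs₁ : Sound T a σ₁ := ⟨by simpa [hσ₁] using h.winner, by simpa [hσ₁] using h.weights,
    by simpa [hσ₁] using h.best⟩
  have hf := frame_flow (n := n) σ₁
  have hs₂ := hs₁.frame hf
  have hspec := flow_spec hm hn (σ := σ₁)
  set σ₂ := flow n σ₁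
  have hs₃ : Sound T a (σ₂.setVal 1 0) := ⟨by simpa using hs₂.winner, by simpa using hs₂.weights,
    by simpa using hs₂.best⟩
  obtain ⟨h₁, h₂, -, h₄⟩ := iterate_tryLevel hs₃ (by simp) m
  have e₀ : (σ₂.setVal 1 0).val 0 = σ.val 0 + 1 := by simp [hf.val, hσ₁]
  have e₁ : (σ₂.setVal 1 0).idx 1 = σ.idx 1 := by simp [hf.opponent, hσ₁]
  have e₂ : (σ₂.setVal 1 0).arr 2 = σ₂.arr 2 := rfl
  refine ⟨h₁, h₂.threshold.trans e₀, h₂.opponent.trans e₁, fun c hc => h₂.found c ?_,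
    fun A hA => ?_⟩
  · simpa [Found, hf.val, hσ₁] using hc
  · have i₀ : σ₁.idx 0 = a := hs₁.winner
    have i₁ : σ₁.idx 1 = σ.idx 1 := rfl
    have i₂ : σ₁.val 0 = σ.val 0 + 1 := by simp [hσ₁]
    have i₃ : σ₁.arr 0 = T.w := hs₁.weights
    rw [i₀, i₁, i₂, i₃] at hspec
    obtain ⟨k, hk, hk₀, hk₁, hk₂⟩ := hspec hA.ne.symm T.le_n
    have hcut : IsCut n a (σ.idx 1) (σ.val 0 + 1)
        (Finset.univ.filter fun x => k < σ₂.arr 2 x x) :=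
      ⟨hA.ne, hA.lt, hA.le, by simpa using hk₀, by simp [hk₁]⟩
    have h₅ := h₄ k hk
    rw [e₀, e₁, e₂] at h₅
    obtain ⟨h₆, h₇⟩ := h₅ hcut
    refine ⟨h₆, h₇.trans ?_⟩
    -- The term for `(y, a)` does not depend on the set, so a minimum cut has minimum cost.
    rw [sum_cutReversalPos hcut, sum_cutReversalPos hA]
    have := hk₂ A hA.mem hA.notMem
    simp only [cutCapacity]
    simp only at this
    omega

theorem iterate_tryThreshold (hm : 2 ≤ m) (hn : 0 < n) {σ : Store m} (h : Sound T a σ)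
    (h₀ : σ.val 0 = 0) (c : ℕ) :
    Sound T a ((tryThreshold n)^[c] σ) ∧ ((tryThreshold n)^[c] σ).val 0 = c ∧
      ((tryThreshold n)^[c] σ).idx 1 = σ.idx 1 ∧
      (∀ c', Found σ c' → Found ((tryThreshold n)^[c] σ) c') ∧
      ∀ v, 0 < v → v ≤ c → Optimal T a (σ.idx 1) v ((tryThreshold n)^[c] σ) := by
  induction c with
  | zero => exact ⟨h, h₀, rfl, fun _ => id, fun v hv hv' => by omega⟩
  | succ c ih =>
    obtain ⟨h₁, h₂, h₃, h₄, h₅⟩ := ih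
    rw [Function.iterate_succ_apply']
    obtain ⟨h₆, h₇, h₈, h₉, h₁₀⟩ := tryThreshold_spec hm hn h₁
    refine ⟨h₆, by rw [h₇, h₂], h₈.trans h₃, fun c' hc' => h₉ _ (h₄ _ hc'), fun v hv hv' => ?_⟩
    rcases Nat.le_succ_iff.1 hv' with hv' | rfl
    · exact fun A hA => h₉ _ (h₅ v hv hv' A hA)
    · rw [h₂, h₃] at h₁₀
      exact h₁₀

theorem tryOpponent_spec (hm : 2 ≤ m) (hn : 0 < n) {σ : Store m} (h : Sound T a σ) :
    Sound T a (tryOpponent n σ) ∧ (∀ c, Found σ c → Found (tryOpponent n σ) c) ∧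
      ∀ v, Optimal T a (σ.idx 1) v (tryOpponent n σ) := by
  have hs : Sound T a (σ.setVal 0 0) := ⟨by simpa using h.winner, by simpa using h.weights,
    by simpa using h.best⟩
  obtain ⟨h₁, -, -, h₄, h₅⟩ := iterate_tryThreshold hm hn hs (by simp) n
  refine ⟨h₁, fun c hc => h₄ c (by simpa [Found] using hc), fun v A hA => ?_⟩
  exact h₅ v (by have := hA.lt; omega) hA.le A hA

theorem tryAll_spec (hm : 2 ≤ m) (hn : 0 < n) {σ : Store m} (h : Sound T a σ) :
    Sound T a (tryAll n σ) ∧ ∀ y v, Optimal T a y v (tryAll n σ) := by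
  -- The index value `x` restored after each round is fixed, while the store varies in the
  -- induction.
  suffices H : ∀ (l : List (Fin m)) (x : Fin m) (σ : Store m), Sound T a σ →
      let τ := l.foldl (fun τ y => (tryOpponent n (τ.setIdx 1 y)).setIdx 1 x) σ
      Sound T a τ ∧ (∀ c, Found σ c → Found τ c) ∧ ∀ y ∈ l, ∀ v, Optimal T a y v τ by
    obtain ⟨h₁, -, h₂⟩ := H (List.finRange m) (σ.idx 1) σ h
    exact ⟨h₁, fun y => h₂ y (List.mem_finRange y)⟩
  intro l x
  induction l with
  | nil => exact fun σ h => ⟨h, fun _ => id, by simp⟩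
  | cons y l ih =>
    intro σ h
    have hs : Sound T a (σ.setIdx 1 y) := ⟨by simpa using h.winner, by simpa using h.weights,
      by simpa using h.best⟩
    obtain ⟨h₁, h₂, h₃⟩ := tryOpponent_spec hm hn hs
    have hs' : Sound T a ((tryOpponent n (σ.setIdx 1 y)).setIdx 1 x) :=
      ⟨by simpa using h₁.winner, by simpa using h₁.weights, by simpa using h₁.best⟩
    obtain ⟨h₄, h₅, h₆⟩ := ih _ hs'
    refine ⟨h₄, fun c hc => h₅ c (h₂ c hc), fun z hz v => ?_⟩
    rcases List.mem_cons.1 hz with rfl | hz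
    · intro A hA
      have := h₃ v A (by simpa using hA)
      refine h₅ _ ?_
      simpa [Found] using this
    · exact h₆ z hz v

/-! ### Input, output and the main theorem -/

/-- The store with the input of the algorithm. -/
def inputStore (T : WeightedTournament (Fin m) n) (a : Fin m) : Store m where
  val _ := 0
  idx i := if i = 0 then a else ⟨0, a.pos⟩
  arr j := if j = 0 then T.w else fun _ _ => 0

theorem represents_inputStore (T : WeightedTournament (Fin m) n) (a : Fin m) :
    Represents n (inputStore T a)
      ⟨Function.update (inputState T a).reg 9 ((inputState T a).reg 2), (inputState T a).mem⟩ where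
  size := by simp [inputState]
  bound := by simp [inputState]
  val i := by
    have h₁ : 3 * i + 8 ≠ 9 := by omega
    simp [inputState, inputStore, h₁]
  idx i := by
    rcases Nat.eq_zero_or_pos i with rfl | hi
    · simp [inputState, inputStore]
    · simp [inputState, inputStore, hi.ne']
  arr j x y := by
    have hm : 0 < m := x.pos
    simp only [inputState, inputStore]
    rcases Nat.eq_zero_or_pos j with rfl | hj
    · have h₁ : (0 * m + x) * m + (y : ℕ) < m * m := by
        have := Nat.mul_le_mul_right m (Nat.succ_le_iff.2 x.2)
        rw [Nat.succ_mul] at this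
        rw [zero_mul, zero_add]
        have := y.2
        omega
      rw [dif_pos h₁, if_pos rfl]
      have h₂ : ((0 * m + x) * m + (y : ℕ)) / m = x := by
        rw [zero_mul, zero_add, mul_comm, Nat.mul_add_div hm, Nat.div_eq_of_lt y.2, add_zero]
      have h₃ : ((0 * m + x) * m + (y : ℕ)) % m = y := by
        rw [zero_mul, zero_add, mul_comm, Nat.mul_add_mod, Nat.mod_eq_of_lt y.2]
      congr 1 <;> exact Fin.ext (by assumption)
    · rw [dif_neg, if_neg hj.ne']
      have := Nat.mul_le_mul_right m (Nat.mul_le_mul_right m (Nat.succ_le_iff.2 hj))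
      rw [Nat.succ_mul, zero_mul, zero_add] at this
      rw [add_mul]
      omega

end MinReversal

end RAM

open WeightedTournament RAM RAM.MinReversal in
/-- One program computes, in time polynomial in the number `m` of alternatives and in `n`, the
margin of victory of a given Split Cycle winner (in register `0`) together with a minimum weighted
destructive reversal set `R` (the positive part of `R x y` at the memory address `x * m + y`). -/
theorem mainTheorem3 :
    ∃ (prog : RAM.Program) (P : Polynomial ℕ),
      ∀ (m n : ℕ), 2 ≤ m → 0 < n →
        ∀ (T : WeightedTournament (Fin m) n) (a : Fin m), a ∈ T.splitCycle →
          ∃ (t : ℕ) (s : RAM.State),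
            RAM.RunsIn prog (RAM.inputState T a) t s ∧
            t ≤ P.eval (m + n) ∧
            WeightedTournament.IsMarginOfVictory WeightedTournament.splitCycle T a
              (s.reg 0 : ℤ) ∧
            ∃ R : T.Reversal,
              WeightedTournament.IsWDRS WeightedTournament.splitCycle T a R ∧
              R.size = (s.reg 0 : ℤ) ∧
              ∀ x y : Fin m, (s.mem ((x : ℕ) * m + (y : ℕ)) : ℤ) = max (R.R x y) 0 := by
  obtain ⟨p, P, hp⟩ := polyImpl_main 0
  -- Register 9 is the index 0, where `a` is expected; register 14 is the value 2, where the size is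
  -- left.
  refine ⟨.seq (.copy 9 2) (.seq p (.copy 0 14)), P + 2, fun m n hm hn T a ha => ?_⟩
  have hs : Sound T a (inputStore T a) := ⟨rfl, rfl, .inl rfl⟩
  obtain ⟨h₁, h₂⟩ := tryAll_spec hm hn hs
  obtain ⟨b, hb⟩ : ∃ b, b ≠ a := by
    have : Nontrivial (Fin m) := Fin.nontrivial_iff_two_le.2 hm
    exact exists_ne a
  -- Raising `(b, a)` to weight `n` with the cut `{a}` is always possible, so some reversal function
  -- has been found.
  obtain ⟨h₃, -⟩ := h₂ b n {a} ⟨hb, by omega, le_rfl, by simp, by simpa using hb⟩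
  obtain ⟨y, v, A, hA, h₄, h₅⟩ := h₁.best.resolve_left h₃
  obtain ⟨t, s, hr, ht, hreg, hmem⟩ : Exec (.seq (.copy 9 2) (.seq p (.copy 0 14)))
      (inputState T a) (1 + (P.eval (m + n) + 1)) fun s =>
        s.reg 0 = ∑ p, ∑ q, T.cutReversalPos a y v A p q ∧
        ∀ x y' : Fin m, s.mem (x * m + y') = T.cutReversalPos a y v A x y' := by
    refine Exec.seq <| Exec.copy <| Exec.seq <|
      (hp m n _ _ (represents_inputStore T a)).mono le_rfl fun s hs => Exec.copy ⟨?_, fun x z => ?_⟩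
    · have := hs.1.val 2
      simp only [Function.update_self]
      rw [this]
      simp [main, h₅]
    · have := hs.1.arr 0 x z
      rw [zero_mul, zero_add] at this
      simp only [this]
      simp [main, h₄]
  refine ⟨t, s, hr, ?_, ⟨⟨T.cutReversal hA, isWDRS_cutReversal hA ha, ?_⟩, ?_⟩,
    T.cutReversal hA, isWDRS_cutReversal hA ha, ?_, fun x z => ?_⟩
  · simp only [Polynomial.eval_add, Polynomial.eval_ofNat]
    omega
  · rw [size_cutReversal, hreg]
  · rintro _ ⟨R, hR, rfl⟩
    -- Any competitor costs at least as much as some cut, and the search has found nothing worse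
    -- than that cut.
    obtain ⟨y', v', A', hA', hle⟩ := hR.exists_cut
    have := (h₂ y' v' A' hA').2
    rw [hreg]
    omega
  · rw [size_cutReversal, hreg]
  · rw [max_cutReversal, hmem]
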